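/- Let $G$ be a locally compact (Hausdorff) group with a fixed left Haar measure $dx$. Assume that $G$ is an $[FC]^-$ group, i.e. for each $x\in G$ the conjugacy class $\{gxg^{-1}: g\in G\}$ has compact closure in $G$. Let $\omega$ be a weight on $G$, i.e. a Borel measurable function $\omega: G\to(0,\infty)$ with $\omega(xy)\le\omega(x)\omega(y)$ for all $x,y\in G$. Let $L^1(G,\omega)$ be the Banach algebra of all (classes of) measurable functions $f:G\to\mathbb{C}$ with $\|f\|_\omega=\int_G|f(x)|\,\omega(x)\,dx<\infty$, with the convolution product and the norm $\|\cdot\|_\omega$, and let $ZL^1(G,\omega)$ be its closed commutative subalgebra consisting of those $f$ such that, for every $g\in G$, $f(g^{-1}xg)=f(x)$ for almost every $x\in G$. Suppose that there is a non-trivial continuous group homomorphism $\Phi: G\to\mathbb{C}$ (into the additive group of $\mathbb{C}$) such that $$\sup_{t\in G}\frac{|\Phi(t)|}{\omega(t)\,\omega(t^{-1})}<\infty .$$ Then $ZL^1(G,\omega)$ is not weakly amenable; that is, there are a commutative Banach $ZL^1(G,\omega)$-module $X$ and a non-zero continuous derivation $D: ZL^1(G,\omega)\to X$. -/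

import Mathlib

set_option linter.unusedSectionVars false

open MeasureTheory Topology Filter
open scoped ENNReal NNReal Pointwise

/-- A weight on `G`: a Borel measurable function `ω : G → (0, ∞)` with `ω (x y) ≤ ω x ω y`. -/
structure Weight (G : Type*) [Group G] [MeasurableSpace G] where
  toFun : G → ℝ
  measurable' : Measurable toFun
  pos' : ∀ x, 0 < toFun x
  mul_le' : ∀ x y, toFun (x * y) ≤ toFun x * toFun y

namespace Weight

section basic
variable {G : Type*} [Group G] [MeasurableSpace G]

instance : CoeFun (Weight G) (fun _ => G → ℝ) := ⟨Weight.toFun⟩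

theorem meas (ω : Weight G) : Measurable (fun x => ω x) := ω.measurable'
theorem pos (ω : Weight G) (x : G) : 0 < ω x := ω.pos' x
theorem mul_le (ω : Weight G) (x y : G) : ω (x * y) ≤ ω x * ω y := ω.mul_le' x y

/-- The measure `ω(x) dx`. -/
noncomputable def measure (ω : Weight G) (μ : Measure G) : Measure G :=
  μ.withDensity fun x => ENNReal.ofReal (ω x)

theorem one_le_one (ω : Weight G) : 1 ≤ ω 1 := by
  have h := ω.mul_le 1 1
  rw [mul_one] at h
  nlinarith [ω.pos 1]

theorem inv_bound (ω : Weight G) (x : G) : 1 ≤ ω x * ω x⁻¹ := by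
  have h := ω.mul_le x x⁻¹
  rw [mul_inv_cancel] at h
  linarith [ω.one_le_one]

theorem measurable_ofReal (ω : Weight G) : Measurable fun x => ENNReal.ofReal (ω x) :=
  ω.meas.ennreal_ofReal

theorem lintegral_measure (ω : Weight G) (μ : Measure G) (f : G → ℝ≥0∞) :
    ∫⁻ x, f x ∂(ω.measure μ) = ∫⁻ x, ENNReal.ofReal (ω x) * f x ∂μ :=
  lintegral_withDensity_eq_lintegral_mul_non_measurable μ ω.measurable_ofReal
    (Eventually.of_forall fun _ => ENNReal.ofReal_lt_top) f

theorem absolutelyContinuous (ω : Weight G) (μ : Measure G) : ω.measure μ ≪ μ :=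
  withDensity_absolutelyContinuous _ _

theorem absolutelyContinuous' (ω : Weight G) (μ : Measure G) : μ ≪ ω.measure μ :=
  withDensity_absolutelyContinuous' ω.measurable_ofReal.aemeasurable
    (Eventually.of_forall fun x => (ENNReal.ofReal_pos.2 (ω.pos x)).ne')

end basic

variable {G : Type*} [Group G] [TopologicalSpace G] [IsTopologicalGroup G] [LocallyCompactSpace G] [T2Space G]
  [MeasurableSpace G] [BorelSpace G] (ω : Weight G)

theorem eventually_le (μ : Measure G) [μ.IsHaarMeasure] [μ.Regular] : ∃ C : ℝ, ∀ᶠ x in 𝓝 (1 : G), ω x ≤ C := by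
  obtain ⟨K, hK, hK1⟩ := exists_compact_mem_nhds (1 : G)
  let S : ℕ → Set G := fun n => {x | ω x ≤ n ∧ ω x⁻¹ ≤ n} ∩ interior K
  have hS : ∀ n, MeasurableSet (S n) := fun n =>
    ((measurableSet_le ω.meas measurable_const).inter
      (measurableSet_le (ω.meas.comp measurable_inv) measurable_const)).inter
      isOpen_interior.measurableSet
  obtain ⟨n, hn⟩ : ∃ n, 0 < μ (S n) := by
    by_contra! h
    have h0 : μ (⋃ n, S n) = 0 := measure_iUnion_null fun n => by simpa using h n
    have h1 : interior K ⊆ ⋃ n, S n := by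
      intro x hx
      obtain ⟨n, hn⟩ := exists_nat_ge (max (ω x) (ω x⁻¹))
      exact Set.mem_iUnion.2 ⟨n, ⟨(le_max_left _ _).trans hn, (le_max_right _ _).trans hn⟩, hx⟩
    have h2 := isOpen_interior.measure_pos μ ⟨1, mem_interior_iff_mem_nhds.2 hK1⟩
    exact h2.ne' (measure_mono_null h1 h0)
  have hfin : μ (S n) ≠ ∞ :=
    measure_ne_top_of_subset (Set.inter_subset_right.trans interior_subset) hK.measure_ne_top
  refine ⟨n * n, ?_⟩
  filter_upwards [Measure.div_mem_nhds_one_of_haar_pos_ne_top μ (S n) (hS n) hn hfin] with x hx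
  obtain ⟨a, ha, b, hb, rfl⟩ := Set.mem_div.1 hx
  rw [div_eq_mul_inv]
  exact (ω.mul_le _ _).trans (mul_le_mul ha.1.1 hb.1.2 (ω.pos _).le (Nat.cast_nonneg n))

theorem bound_of_isCompact (μ : Measure G) [μ.IsHaarMeasure] [μ.Regular] {K : Set G} (hK : IsCompact K) : ∃ C : ℝ, 0 < C ∧ ∀ x ∈ K, ω x ≤ C := by
  obtain ⟨C, hC⟩ := ω.eventually_le μ
  have hC0 : 0 < C := lt_of_lt_of_le (ω.pos 1) hC.self_of_nhds
  refine hK.induction_on (p := fun s => ∃ C : ℝ, 0 < C ∧ ∀ x ∈ s, ω x ≤ C) ⟨1, one_pos, by simp⟩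
    (fun s t hst ⟨D, h0, hD⟩ => ⟨D, h0, fun x hx => hD x (hst hx)⟩)
    (fun s t ⟨D, h0, hD⟩ ⟨E, _, hE⟩ => ⟨max D E, lt_max_of_lt_left h0, ?_⟩) ?_
  · rintro x (hx | hx)
    · exact (hD x hx).trans (le_max_left _ _)
    · exact (hE x hx).trans (le_max_right _ _)
  · intro x _
    refine ⟨{y | ω y ≤ ω x * C}, mem_nhdsWithin_of_mem_nhds ?_, ω x * C,
      mul_pos (ω.pos x) hC0, fun y hy => hy⟩
    have : Tendsto (fun y => x⁻¹ * y) (𝓝 x) (𝓝 1) := by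
      have := (continuous_const_mul x⁻¹).tendsto x
      rwa [inv_mul_cancel] at this
    filter_upwards [this.eventually hC] with y hy
    have := ω.mul_le x (x⁻¹ * y)
    rw [mul_inv_cancel_left] at this
    exact this.trans (mul_le_mul_of_nonneg_left hy (ω.pos x).le)

instance (μ : Measure G) [μ.IsHaarMeasure] [μ.Regular] :
    IsFiniteMeasureOnCompacts (ω.measure μ) where
  lt_top_of_isCompact K hK := by
    obtain ⟨C, _, hC⟩ := ω.bound_of_isCompact μ hK
    rw [measure, withDensity_apply _ hK.measurableSet]
    refine (setLIntegral_mono measurable_const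
      fun x hx => ENNReal.ofReal_le_ofReal (hC x hx)).trans_lt ?_
    rw [setLIntegral_const]
    exact ENNReal.mul_lt_top ENNReal.ofReal_lt_top hK.measure_lt_top

theorem exists_compact_subset (μ : Measure G) [μ.IsHaarMeasure] [μ.Regular] {t : Set G}
    (ht : MeasurableSet t) (htν : ω.measure μ t < ∞) {η : ℝ≥0∞} (hη : η ≠ 0) :
    ∃ K ⊆ t, IsCompact K ∧ ω.measure μ (t \ K) ≤ η := by
  let s : ℕ → Set G := fun n => {x | ω x < 1 / ((n : ℝ) + 1)}
  have hs : ∀ n, MeasurableSet (s n) := fun n => measurableSet_lt ω.meas measurable_const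
  have hlim : Tendsto (fun n => ω.measure μ (t ∩ s n)) atTop (𝓝 (ω.measure μ (⋂ n, t ∩ s n))) := by
    refine tendsto_measure_iInter_atTop (fun n => (ht.inter (hs n)).nullMeasurableSet) ?_
      ⟨0, (measure_mono Set.inter_subset_left).trans_lt htν |>.ne⟩
    intro m n hmn x hx
    refine ⟨hx.1, lt_of_lt_of_le (b := 1 / ((n : ℝ) + 1)) hx.2 ?_⟩
    exact one_div_le_one_div_of_le (by positivity) (by exact_mod_cast Nat.succ_le_succ hmn)
  have hemp : (⋂ n, t ∩ s n) = ∅ := by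
    ext x
    simp only [Set.mem_iInter, Set.mem_empty_iff_false, iff_false, not_forall]
    obtain ⟨n, hn⟩ := exists_nat_one_div_lt (ω.pos x)
    exact ⟨n, fun h => lt_asymm h.2 hn⟩
  rw [hemp, measure_empty] at hlim
  obtain ⟨n, hn⟩ := (hlim.eventually (gt_mem_nhds (ENNReal.half_pos hη))).exists
  set tn := t \ s n
  have htn : MeasurableSet tn := ht.diff (hs n)
  have hfinν : ∫⁻ x in tn, ENNReal.ofReal (ω x) ∂μ ≠ ∞ := by
    rw [← withDensity_apply _ htn]
    exact ((measure_mono Set.sdiff_subset).trans_lt htν).ne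
  have hfin : μ tn ≠ ∞ := by
    intro h
    apply hfinν
    rw [eq_top_iff]
    calc (∞ : ℝ≥0∞) = ENNReal.ofReal (1 / ((n : ℝ) + 1)) * μ tn := by
          rw [h, ENNReal.mul_top]
          exact (ENNReal.ofReal_pos.2 (by positivity)).ne'
      _ = ∫⁻ x in tn, ENNReal.ofReal (1 / ((n : ℝ) + 1)) ∂μ := by rw [setLIntegral_const]
      _ ≤ _ := setLIntegral_mono ω.measurable_ofReal
          fun x hx => ENNReal.ofReal_le_ofReal (not_lt.1 hx.2)
  obtain ⟨δ, hδ, hδ'⟩ := exists_pos_setLIntegral_lt_of_measure_lt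
    (μ := μ.restrict tn) hfinν (ENNReal.half_pos hη).ne'
  obtain ⟨K, hK, hKc, -, hKμ⟩ := htn.exists_isCompact_isClosed_sdiff_lt hfin hδ.ne'
  refine ⟨K, hK.trans Set.sdiff_subset, hKc, ?_⟩
  have h1 : t \ K ⊆ (t ∩ s n) ∪ (tn \ K) := by
    intro x hx
    by_cases h : x ∈ s n
    · exact Or.inl ⟨hx.1, h⟩
    · exact Or.inr ⟨⟨hx.1, h⟩, hx.2⟩
  have hm : MeasurableSet (tn \ K) := htn.diff hKc.measurableSet
  have h2 : ω.measure μ (tn \ K) < η / 2 := by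
    rw [measure, withDensity_apply _ hm]
    have := hδ' (tn \ K) (by rwa [Measure.restrict_apply hm, Set.inter_eq_left.2 Set.sdiff_subset])
    rwa [Measure.restrict_restrict hm, Set.inter_eq_left.2 Set.sdiff_subset] at this
  calc _ ≤ _ := measure_mono h1
    _ ≤ _ := measure_union_le _ _
    _ ≤ η / 2 + η / 2 := add_le_add hn.le h2.le
    _ = η := ENNReal.add_halves η

theorem exists_continuous_approx (μ : Measure G) [μ.IsHaarMeasure] [μ.Regular] {f : G → ℂ}
    (hf : MemLp f 1 (ω.measure μ)) {ε : ℝ≥0∞} (hε : ε ≠ 0) :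
    ∃ g : G → ℂ, eLpNorm (f - g) 1 (ω.measure μ) ≤ ε ∧ Continuous g ∧ HasCompactSupport g := by
  apply hf.induction_dense ENNReal.one_ne_top _ _ _ _ hε
  rotate_left
  · exact fun f g hf hg => ⟨hf.1.add hg.1, hf.2.add hg.2⟩
  · exact fun f hf => hf.1.aestronglyMeasurable
  intro c t ht htν ε hε
  obtain ⟨η, hη0, hη⟩ : ∃ η : ℝ≥0∞, η ≠ 0 ∧ ‖c‖ₑ * η ≤ ε / 2 := by
    refine ⟨ε / 2 / ‖c‖ₑ, ?_, ENNReal.mul_div_le⟩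
    exact (ENNReal.div_pos (ENNReal.half_pos hε).ne' enorm_ne_top).ne'
  obtain ⟨K, hKt, hK, hKν⟩ := ω.exists_compact_subset μ ht htν hη0
  obtain ⟨K', hK', hKK'⟩ := exists_compact_superset hK
  obtain ⟨C, hC0, hC⟩ := ω.bound_of_isCompact μ hK'
  have hη1 : η / ENNReal.ofReal C ≠ 0 := (ENNReal.div_pos hη0 ENNReal.ofReal_ne_top).ne'
  obtain ⟨V, hKV, hV, -, hVμ⟩ :=
    hK.measurableSet.exists_isOpen_sdiff_lt (μ := μ) hK.measure_ne_top hη1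
  have hKV' : K ⊆ V ∩ interior K' := Set.subset_inter hKV hKK'
  obtain ⟨χ, hχ1, hχ0, -, hχ⟩ := exists_continuous_one_zero_of_isCompact hK
    (hV.inter isOpen_interior).isClosed_compl (Set.disjoint_compl_right_iff_subset.2 hKV')
  let g : G → ℂ := fun x => χ x • c
  have g_cont : Continuous g := χ.continuous.smul continuous_const
  have g_zero : ∀ x, x ∉ V ∩ interior K' → g x = 0 := fun x hx => by
    have : χ x = 0 := hχ0 hx
    simp [g, this]
  let W := (V ∩ interior K') \ K
  have hW : MeasurableSet W := (hV.inter isOpen_interior).measurableSet.diff hK.measurableSet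
  have g_le : ∀ x, ‖(g - K.indicator fun _ => c) x‖ ≤ ‖W.indicator (fun _ => c) x‖ := by
    intro x
    by_cases hx : x ∈ K
    · have : χ x = 1 := hχ1 hx
      simp [g, this, hx]
    · by_cases hx' : x ∈ V ∩ interior K'
      · have h1 : ‖χ x‖ ≤ 1 := by
          rw [Real.norm_eq_abs, abs_of_nonneg (hχ x).1]; exact (hχ x).2
        have hxW : x ∈ W := ⟨hx', hx⟩
        simp only [Pi.sub_apply, Set.indicator_of_notMem hx, sub_zero, g, norm_smul,
          Set.indicator_of_mem hxW]
        exact mul_le_of_le_one_left (norm_nonneg _) h1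
      · simp [g_zero x hx', hx]
  have hWν : ω.measure μ W ≤ η := by
    rw [measure, withDensity_apply _ hW]
    refine (setLIntegral_mono measurable_const
      fun x hx => ENNReal.ofReal_le_ofReal (hC x (interior_subset hx.1.2))).trans ?_
    rw [setLIntegral_const]
    have : μ W ≤ η / ENNReal.ofReal C :=
      (measure_mono (Set.sdiff_subset_sdiff_left Set.inter_subset_left)).trans hVμ.le
    exact (mul_le_mul_right this _).trans ENNReal.mul_div_le
  refine ⟨g, ?_, g_cont, HasCompactSupport.intro hK' fun x hx => g_zero x fun h =>
    hx (interior_subset h.2)⟩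
  have h1 : eLpNorm (g - K.indicator fun _ => c) 1 (ω.measure μ) ≤ ε / 2 := by
    refine (eLpNorm_mono g_le).trans ((eLpNorm_indicator_const_le _ _).trans ?_)
    simp only [ENNReal.toReal_one, div_one, ENNReal.rpow_one]
    exact (mul_le_mul_right hWν _).trans hη
  have h2 : eLpNorm ((K.indicator fun _ => c) - t.indicator fun _ => c) 1 (ω.measure μ) ≤ ε / 2 := by
    rw [← eLpNorm_neg, neg_sub, ← Set.indicator_sdiff hKt]
    refine (eLpNorm_indicator_const_le _ _).trans ?_
    simp only [ENNReal.toReal_one, div_one, ENNReal.rpow_one]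
    exact (mul_le_mul_right hKν _).trans hη
  calc _ = eLpNorm ((g - K.indicator fun _ => c) +
        ((K.indicator fun _ => c) - t.indicator fun _ => c)) 1 (ω.measure μ) := by
        rw [sub_add_sub_cancel]
    _ ≤ _ := eLpNorm_add_le
        (g_cont.aestronglyMeasurable.sub
          (aestronglyMeasurable_const.indicator hK.measurableSet))
        ((aestronglyMeasurable_const.indicator hK.measurableSet).sub
          (aestronglyMeasurable_const.indicator ht)) le_rfl
    _ ≤ ε / 2 + ε / 2 := add_le_add h1 h2
    _ = ε := ENNReal.add_halves ε

end Weight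

section groupConv

variable {G : Type*} [Group G] [TopologicalSpace G] [IsTopologicalGroup G] [LocallyCompactSpace G]
  [T2Space G] [MeasurableSpace G] [BorelSpace G]

/-- The convolution `(f * h)(x) = ∫ f(y) h(y⁻¹ x) dy`. -/
noncomputable def groupConv {G : Type*} [Group G] [MeasurableSpace G] {𝕜 : Type*} [RCLike 𝕜]
    (μ : Measure G) (f h : G → 𝕜) (x : G) : 𝕜 :=
  ∫ y, f y * h (y⁻¹ * x) ∂μ

variable {𝕜 : Type*} [RCLike 𝕜] (μ : Measure G) [μ.IsHaarMeasure] [μ.Regular]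

theorem conv_support {F H : G → 𝕜} {x y : G} (hy : F y * H (y⁻¹ * x) ≠ 0) :
    y ∈ tsupport F ∧ x ∈ tsupport F * tsupport H := by
  have h1 : y ∈ tsupport F := subset_tsupport _ (left_ne_zero_of_mul hy)
  have h2 : y⁻¹ * x ∈ tsupport H := subset_tsupport _ (right_ne_zero_of_mul hy)
  exact ⟨h1, y, h1, y⁻¹ * x, h2, by simp⟩

theorem conv_hasCompactSupport_uncurry {F H : G → 𝕜} (hF : HasCompactSupport F)
    (hH : HasCompactSupport H) :
    HasCompactSupport (Function.uncurry fun y x => F y * H (y⁻¹ * x)) := by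
  refine HasCompactSupport.intro (hF.prod (hF.mul hH)) ?_
  rintro ⟨y, x⟩ h
  by_contra h'
  exact h (conv_support h')

theorem conv_continuous {F H : G → 𝕜} (hF : Continuous F) (hF' : HasCompactSupport F)
    (hH : Continuous H) : Continuous (groupConv μ F H) := by
  rw [← continuousOn_univ]
  refine continuousOn_integral_of_compact_support (k := tsupport F) hF' ?_ ?_
  · apply Continuous.continuousOn
    simp only [Function.uncurry_def]
    fun_prop
  · intro x y _ hy
    simp [image_eq_zero_of_notMem_tsupport hy]

theorem conv_hasCompactSupport {F H : G → 𝕜} (hF : HasCompactSupport F)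
    (hH : HasCompactSupport H) : HasCompactSupport (groupConv μ F H) := by
  refine HasCompactSupport.intro (hF.mul hH) fun x hx => ?_
  refine integral_eq_zero_of_ae (Eventually.of_forall fun y => ?_)
  by_contra h'
  exact hx (conv_support h').2

theorem conv_integrable {F H : G → 𝕜} (hF : Continuous F) (hF' : HasCompactSupport F)
    (hH : Continuous H) (x : G) : Integrable (fun y => F y * H (y⁻¹ * x)) μ := by
  apply Continuous.integrable_of_hasCompactSupport
  · fun_prop
  · exact hF'.mul_right

variable (ω : Weight G)

theorem Weight.integral_measure {G : Type*} [Group G] [MeasurableSpace G] (ω : Weight G)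
    (μ : Measure G) {E : Type*} [NormedAddCommGroup E] [NormedSpace ℝ E] (f : G → E) :
    ∫ x, f x ∂(ω.measure μ) = ∫ x, ω x • f x ∂μ := by
  rw [Weight.measure, integral_withDensity_eq_integral_toReal_smul ω.measurable_ofReal
    (Eventually.of_forall fun _ => ENNReal.ofReal_lt_top)]
  simp_rw [ENNReal.toReal_ofReal (ω.pos _).le]

theorem integral_translate_le {b : G → ℝ} (hb : Continuous b) (hb' : HasCompactSupport b)
    (hb0 : ∀ x, 0 ≤ b x) (y : G) :
    ∫ x, b (y⁻¹ * x) ∂(ω.measure μ) ≤ ω y * ∫ x, b x ∂(ω.measure μ) := by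
  rw [ω.integral_measure, ω.integral_measure]
  have h1 : ∫ x, ω x • b (y⁻¹ * x) ∂μ = ∫ x, ω (y * x) • b x ∂μ := by
    rw [← integral_mul_left_eq_self _ y]
    simp
  rw [h1, ← integral_const_mul]
  refine integral_mono_of_nonneg (Eventually.of_forall fun x =>
    mul_nonneg (ω.pos _).le (hb0 x)) ?_ (Eventually.of_forall fun x => ?_)
  · apply Integrable.const_mul
    have := hb.integrable_of_hasCompactSupport (μ := ω.measure μ) hb'
    rw [Weight.measure, integrable_withDensity_iff_integrable_smul' ω.measurable_ofReal
      (Eventually.of_forall fun _ => ENNReal.ofReal_lt_top)] at this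
    simpa only [ENNReal.toReal_ofReal (ω.pos _).le] using this
  · simp only [smul_eq_mul, ← mul_assoc]
    exact mul_le_mul_of_nonneg_right (ω.mul_le y x) (hb0 x)

theorem integral_conv_le {a b : G → ℝ} (ha : Continuous a) (ha' : HasCompactSupport a)
    (ha0 : ∀ x, 0 ≤ a x) (hb : Continuous b) (hb' : HasCompactSupport b) (hb0 : ∀ x, 0 ≤ b x) :
    ∫ x, groupConv μ a b x ∂(ω.measure μ) ≤ (∫ x, a x ∂(ω.measure μ)) * ∫ x, b x ∂(ω.measure μ) := by
  unfold groupConv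
  rw [← integral_integral_swap_of_hasCompactSupport (f := fun y x => a y * b (y⁻¹ * x))
    (by simp only [Function.uncurry_def]; fun_prop) (conv_hasCompactSupport_uncurry ha' hb')]
  simp_rw [integral_const_mul]
  rw [ω.integral_measure (f := a), ← integral_mul_const]
  have hint : Integrable (fun x => ω x • a x) μ := by
    have := ha.integrable_of_hasCompactSupport (μ := ω.measure μ) ha'
    rw [Weight.measure, integrable_withDensity_iff_integrable_smul' ω.measurable_ofReal
      (Eventually.of_forall fun _ => ENNReal.ofReal_lt_top)] at this
    simpa only [ENNReal.toReal_ofReal (ω.pos _).le] using this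
  refine integral_mono_of_nonneg (Eventually.of_forall fun y =>
    mul_nonneg (ha0 y) (integral_nonneg fun x => hb0 _)) (hint.mul_const _)
    (Eventually.of_forall fun y => ?_)
  have := mul_le_mul_of_nonneg_left (integral_translate_le μ ω hb hb' hb0 y) (ha0 y)
  simp only [smul_eq_mul]
  linarith

theorem conv_assoc_of_continuous {F H L : G → 𝕜} (hF : Continuous F) (hF' : HasCompactSupport F)
    (hH : Continuous H) (hH' : HasCompactSupport H) (hL : Continuous L) : groupConv μ (groupConv μ F H) L = groupConv μ F (groupConv μ H L) := by
  funext x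
  unfold groupConv
  have h1 : ∀ y, (∫ z, F z * H (z⁻¹ * y) ∂μ) * L (y⁻¹ * x) =
      ∫ z, F z * H (z⁻¹ * y) * L (y⁻¹ * x) ∂μ := fun y => (integral_mul_const _ _).symm
  simp_rw [h1]
  rw [← integral_integral_swap_of_hasCompactSupport
    (f := fun z y => F z * H (z⁻¹ * y) * L (y⁻¹ * x))
    (by simp only [Function.uncurry_def]; fun_prop)
    (HasCompactSupport.mul_right (f := Function.uncurry fun y x => F y * H (y⁻¹ * x))
      (conv_hasCompactSupport_uncurry hF' hH'))]
  congr 1 with z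
  rw [← integral_const_mul, ← integral_mul_left_eq_self _ z]
  congr 1 with y
  simp [mul_assoc]

end groupConv

section inv

variable {G : Type*} [Group G] [TopologicalSpace G] [IsTopologicalGroup G] [LocallyCompactSpace G]
  [T2Space G] [MeasurableSpace G] [BorelSpace G] (μ : Measure G) [μ.IsHaarMeasure] [μ.Regular]

/-- The inverse of a compact null set is a null set. -/
theorem measure_inv_eq_zero_of_isCompact {K : Set G} (hK : IsCompact K) (h0 : μ K = 0) :
    μ K⁻¹ = 0 := by
  obtain ⟨W, hW, hKW⟩ := exists_compact_superset hK
  obtain ⟨L, hL, hL1⟩ := exists_compact_mem_nhds (1 : G)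
  have hLpos : 0 < (μ L).toReal :=
    ENNReal.toReal_pos (Measure.measure_pos_of_mem_nhds μ hL1).ne' hL.measure_ne_top
  obtain ⟨ψ, hψ1, -, hψc, hψ⟩ := exists_continuous_one_zero_of_isCompact (hL.mul hW.inv)
    isClosed_empty (Set.disjoint_empty _)
  have hψ0 : 0 ≤ ∫ x, ψ x ∂μ := integral_nonneg fun x => (hψ x).1
  by_contra hne
  have hKfin : μ K⁻¹ ≠ ∞ := hK.inv.measure_ne_top
  have hpos : 0 < (μ K⁻¹).toReal := ENNReal.toReal_pos hne hKfin
  let ε : ℝ := (μ L).toReal * (μ K⁻¹).toReal / (2 * (∫ x, ψ x ∂μ + 1))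
  have hε : 0 < ε := by positivity
  obtain ⟨V, hKV, hV, hVμ⟩ := K.exists_isOpen_lt_of_lt (μ := μ) (ENNReal.ofReal ε)
    (by rw [h0]; exact ENNReal.ofReal_pos.2 hε)
  obtain ⟨φ, hφ1, hφ0, hφc, hφ⟩ := exists_continuous_one_zero_of_isCompact hK
    (hV.inter isOpen_interior).isClosed_compl
    (Set.disjoint_compl_right_iff_subset.2 (Set.subset_inter hKV hKW))
  have hφW : ∀ x, φ x ≠ 0 → x ∈ V ∩ W := by
    intro x hx
    by_contra h
    exact hx (hφ0 fun h' => h ⟨h'.1, interior_subset h'.2⟩)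
  have hφint : ∫ x, φ x ∂μ ≤ ε := by
    have h1 : ∫ x, φ x ∂μ ≤ ∫ x, V.indicator (fun _ => (1 : ℝ)) x ∂μ := by
      refine integral_mono (φ.continuous.integrable_of_hasCompactSupport hφc)
        ((integrable_indicator_iff hV.measurableSet).2
          (integrableOn_const (hVμ.trans ENNReal.ofReal_lt_top).ne)) fun x => ?_
      by_cases hx : x ∈ V
      · simpa [hx] using (hφ x).2
      · have : φ x = 0 := by
          by_contra h
          exact hx (hφW x h).1
        simp [hx, this]
    rw [integral_indicator hV.measurableSet, setIntegral_const, smul_eq_mul, mul_one] at h1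
    exact h1.trans (ENNReal.toReal_le_of_le_ofReal hε.le hVμ.le)
  have e1 : ∫ x, groupConv μ ψ φ x ∂μ = (∫ x, ψ x ∂μ) * ∫ x, φ x ∂μ := by
    unfold groupConv
    rw [← integral_integral_swap_of_hasCompactSupport (f := fun y x => ψ y * φ (y⁻¹ * x))
      (by simp only [Function.uncurry_def]; fun_prop) (conv_hasCompactSupport_uncurry hψc hφc)]
    simp_rw [integral_const_mul, integral_mul_left_eq_self]
    rw [integral_mul_const]
  have e2 : ∫ x, groupConv μ ψ φ x ∂μ = ∫ z, φ z⁻¹ * ∫ x, ψ (x * z) ∂μ ∂μ := by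
    have h1 : ∀ x, groupConv μ ψ φ x = ∫ z, φ z⁻¹ * ψ (x * z) ∂μ := by
      intro x
      unfold groupConv
      rw [← integral_mul_left_eq_self _ x]
      simp [mul_comm]
    simp_rw [h1, ← integral_const_mul]
    refine integral_integral_swap_of_hasCompactSupport
      (f := fun x z => φ z⁻¹ * ψ (x * z)) (by simp only [Function.uncurry_def]; fun_prop) ?_
    refine HasCompactSupport.intro ((hψc.mul hW).prod hW.inv) ?_
    rintro ⟨x, z⟩ h
    by_contra h'
    have h2 := (hφW _ (left_ne_zero_of_mul h')).2
    have h3 : x * z ∈ tsupport ψ := subset_tsupport _ (right_ne_zero_of_mul h')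
    exact h ⟨⟨x * z, h3, z⁻¹, h2, by simp⟩, h2⟩
  have e3 : (μ L).toReal * (μ K⁻¹).toReal ≤ ∫ z, φ z⁻¹ * ∫ x, ψ (x * z) ∂μ ∂μ := by
    have hcont : Continuous fun z => φ z⁻¹ * ∫ x, ψ (x * z) ∂μ := by
      simp_rw [← integral_const_mul]
      rw [← continuousOn_univ]
      refine continuousOn_integral_of_compact_support (k := tsupport ψ * W) (hψc.mul hW) ?_ ?_
      · apply Continuous.continuousOn
        simp only [Function.uncurry_def]
        fun_prop
      · intro z x _ hx
        by_contra h'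
        have h2 := (hφW _ (left_ne_zero_of_mul h')).2
        have h3 : x * z ∈ tsupport ψ := subset_tsupport _ (right_ne_zero_of_mul h')
        exact hx ⟨x * z, h3, z⁻¹, h2, by simp⟩
    have h1 : ∫ z, K⁻¹.indicator (fun _ => (μ L).toReal) z ∂μ = (μ L).toReal * (μ K⁻¹).toReal := by
      rw [integral_indicator hK.inv.measurableSet, setIntegral_const, smul_eq_mul, mul_comm]
      rfl
    rw [← h1]
    refine integral_mono ((integrable_indicator_iff hK.inv.measurableSet).2
          (integrableOn_const hKfin)) ?_ fun z => ?_
    · refine hcont.integrable_of_hasCompactSupport ?_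
      refine HasCompactSupport.mul_right (HasCompactSupport.intro hW.inv fun z hz => ?_)
      by_contra h
      exact hz (hφW _ h).2
    · by_cases hz : z ∈ K⁻¹
      · have h2 : φ z⁻¹ = 1 := hφ1 hz
        simp only [hz, Set.indicator_of_mem, h2, one_mul]
        have h3 : ∫ x, L.indicator (fun _ => (1 : ℝ)) x ∂μ = (μ L).toReal := by
          rw [integral_indicator hL.measurableSet, setIntegral_const, smul_eq_mul, mul_one]
          rfl
        rw [← h3]
        refine integral_mono ((integrable_indicator_iff hL.measurableSet).2
          (integrableOn_const hL.measure_ne_top)) ?_ fun x => ?_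
        · exact (ψ.continuous.comp (continuous_mul_const z)).integrable_of_hasCompactSupport
            (hψc.comp_homeomorph (Homeomorph.mulRight z))
        · by_cases hx : x ∈ L
          · have : ψ (x * z) = 1 :=
              hψ1 ⟨x, hx, z, by simpa using interior_subset (hKW hz), rfl⟩
            simp [hx, this]
          · simpa [hx] using (hψ _).1
      · simp only [hz, not_false_eq_true, Set.indicator_of_notMem]
        exact mul_nonneg (hφ _).1 (integral_nonneg fun x => (hψ _).1)
  have e4 : (μ L).toReal * (μ K⁻¹).toReal ≤ (∫ x, ψ x ∂μ) * ε :=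
    e3.trans (by rw [← e2, e1]; exact mul_le_mul_of_nonneg_left hφint hψ0)
  have e5 : (∫ x, ψ x ∂μ + 1) * ε * 2 = (μ L).toReal * (μ K⁻¹).toReal := by
    simp only [ε]
    field_simp
  nlinarith [mul_pos hLpos hpos]

end inv

section approx

variable {G : Type*} [Group G] [TopologicalSpace G] [IsTopologicalGroup G] [LocallyCompactSpace G]
  [T2Space G] [MeasurableSpace G] [BorelSpace G]
  (μ : Measure G) [μ.IsHaarMeasure] [μ.Regular] (ω : Weight G)

theorem ae_inv_mul_notMem {f : G → ℂ} (hf : MemLp f 1 (ω.measure μ)) {N : Set G}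
    (hN : MeasurableSet N) (hN0 : μ N = 0) (x : G) :
    ∀ᵐ y ∂μ, f y ≠ 0 → y⁻¹ * x ∉ N := by
  obtain ⟨g, hg, hfg⟩ := hf.1
  have hgi : MemLp g 1 (ω.measure μ) := hf.ae_eq hfg
  have hgm : Measurable g := hg.measurable
  have hN' : MeasurableSet {y : G | y⁻¹ * x ∈ N} := by
    have : Measurable fun y : G => y⁻¹ * x := (by fun_prop : Continuous _).measurable
    exact this hN
  have key : ∀ n : ℕ, ω.measure μ ({y | y⁻¹ * x ∈ N} ∩ {y | 1 / ((n : ℝ) + 1) ≤ ‖g y‖}) = 0 := by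
    intro n
    set A := {y | y⁻¹ * x ∈ N} ∩ {y | 1 / ((n : ℝ) + 1) ≤ ‖g y‖}
    have hA : MeasurableSet A := hN'.inter (measurableSet_le measurable_const hgm.norm)
    have hAfin : ω.measure μ A < ∞ := by
      refine (measure_mono Set.inter_subset_right).trans_lt ?_
      exact (memLp_one_iff_integrable.1 hgi).measure_norm_ge_lt_top (by positivity)
    refine nonpos_iff_eq_zero.1 (ENNReal.le_of_forall_pos_le_add fun ε hε _ => ?_)
    obtain ⟨K, hKA, hK, hKε⟩ := ω.exists_compact_subset μ hA hAfin (ENNReal.coe_ne_zero.2 hε.ne')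
    have h1 : μ ((fun y => y⁻¹ * x) '' K) = 0 := by
      refine measure_mono_null ?_ hN0
      rintro _ ⟨y, hy, rfl⟩
      exact (hKA hy).1
    have h2 := measure_inv_eq_zero_of_isCompact μ (hK.image (by fun_prop)) h1
    have h3 : μ K = 0 := by
      rw [← measure_preimage_mul μ x]
      refine measure_mono_null ?_ h2
      intro z hz
      exact ⟨x * z, hz, by simp⟩
    have h4 : ω.measure μ K = 0 := ω.absolutelyContinuous μ h3
    calc ω.measure μ A ≤ ω.measure μ (A \ K ∪ K) := by
          refine measure_mono fun y hy => ?_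
          by_cases h : y ∈ K
          · exact Or.inr h
          · exact Or.inl ⟨hy, h⟩
      _ ≤ _ := measure_union_le _ _
      _ ≤ 0 + ε := by rw [h4, zero_add, add_zero]; exact hKε
  have h0 : ω.measure μ (⋃ n : ℕ, {y | y⁻¹ * x ∈ N} ∩ {y | 1 / ((n : ℝ) + 1) ≤ ‖g y‖}) = 0 :=
    measure_iUnion_null key
  have h1 := measure_eq_zero_iff_ae_notMem.1 (ω.absolutelyContinuous' μ h0)
  filter_upwards [h1, (ω.absolutelyContinuous' μ).ae_eq hfg] with y hy hfy hf0 hyN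
  apply hy
  rw [hfy] at hf0
  obtain ⟨n, hn⟩ := exists_nat_one_div_lt (norm_pos_iff.2 hf0)
  exact Set.mem_iUnion.2 ⟨n, hyN, hn.le⟩

/-- `F n` are continuous functions with compact support that approximate `f` rapidly. -/
structure IsApprox (f : G → ℂ) (F : ℕ → G → ℂ) (S : ℕ → G → ℝ) (M : ℝ) : Prop where
  cont : ∀ n, Continuous (F n)
  supp : ∀ n, HasCompactSupport (F n)
  contS : ∀ n, Continuous (S n)
  suppS : ∀ n, HasCompactSupport (S n)
  le : ∀ n x, ‖F n x‖ ≤ S n x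
  mono : ∀ x, Monotone fun n => S n x
  bound : ∀ n, ∫ x, S n x ∂(ω.measure μ) ≤ M
  ae : ∀ᵐ x ∂μ, Tendsto (fun n => F n x) atTop (𝓝 (f x))
  lim : Tendsto (fun n => eLpNorm (F n - f) 1 (ω.measure μ)) atTop (𝓝 0)

theorem exists_isApprox {f : G → ℂ} (hf : MemLp f 1 (ω.measure μ)) :
    ∃ F S M, IsApprox μ ω f F S M := by
  have h0 : ∀ n : ℕ, ((2⁻¹ : ℝ≥0∞)) ^ n ≠ 0 := fun n => by simp
  choose F hF hFc hFs using fun n => ω.exists_continuous_approx μ hf (h0 n)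
  have hFi : ∀ n, Integrable (F n) (ω.measure μ) := fun n =>
    (hFc n).integrable_of_hasCompactSupport (hFs n)
  have hFm : ∀ n, MemLp (F n) 1 (ω.measure μ) := fun n => memLp_one_iff_integrable.2 (hFi n)
  have hdiff : ∀ n, ∫ x, ‖F (n + 1) x - F n x‖ ∂(ω.measure μ) ≤ 2 * (1 / 2) ^ n := by
    intro n
    have h1 : eLpNorm (F (n + 1) - F n) 1 (ω.measure μ) ≤ 2 * (2⁻¹) ^ n := by
      calc _ = eLpNorm ((f - F n) - (f - F (n + 1))) 1 (ω.measure μ) := by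
            rw [sub_sub_sub_cancel_left]
        _ ≤ _ := eLpNorm_sub_le (hf.sub (hFm n)).1 (hf.sub (hFm (n + 1))).1 le_rfl
        _ ≤ (2⁻¹) ^ n + (2⁻¹) ^ (n + 1) := add_le_add (hF n) (hF (n + 1))
        _ ≤ (2⁻¹) ^ n + (2⁻¹) ^ n := by
            gcongr 1
            exact pow_le_pow_right_of_le_one' (by simp) (Nat.le_succ n)
        _ = _ := (two_mul _).symm
    have h3 := integral_norm_eq_lintegral_enorm ((hFi (n + 1)).sub (hFi n)).1
    simp only [Pi.sub_apply] at h3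
    rw [h3]
    rw [eLpNorm_one_eq_lintegral_enorm] at h1
    have h2 := ENNReal.toReal_mono (by finiteness) h1
    simpa using h2
  refine ⟨F, fun n x => ‖F 0 x‖ + ∑ k ∈ Finset.range n, ‖F (k + 1) x - F k x‖,
    ∫ x, ‖F 0 x‖ ∂(ω.measure μ) + 4, hFc, hFs, fun n => ?_, fun n => ?_, fun n x => ?_,
    fun x => ?_, fun n => ?_, ?_, ?_⟩
  · have := hFc 0
    refine this.norm.add (continuous_finsetSum _ fun k _ => ((hFc _).sub (hFc _)).norm)
  · induction n with
    | zero => simpa using (hFs 0).norm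
    | succ n ih =>
      simp_rw [Finset.sum_range_succ, ← add_assoc]
      exact ih.add ((hFs (n + 1)).sub (hFs n)).norm
  · induction n with
    | zero => simp
    | succ n ih =>
      rw [Finset.sum_range_succ, ← add_assoc]
      have : F (n + 1) x = F n x + (F (n + 1) x - F n x) := by ring
      rw [this]
      refine (norm_add_le _ _).trans ?_
      gcongr
      simp
  · refine monotone_nat_of_le_succ fun n => ?_
    simp only [Finset.sum_range_succ]
    linarith [norm_nonneg (F (n + 1) x - F n x)]
  · have hd : ∀ k, Integrable (fun x => ‖F (k + 1) x - F k x‖) (ω.measure μ) := fun k =>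
      ((hFi _).sub (hFi _)).norm
    rw [integral_add (hFi 0).norm (integrable_finsetSum _ fun k _ => hd k),
      integral_finsetSum _ fun k _ => hd k]
    gcongr
    calc _ ≤ ∑ k ∈ Finset.range n, 2 * (1 / 2 : ℝ) ^ k := Finset.sum_le_sum fun k _ => hdiff k
      _ = 2 * ∑ k ∈ Finset.range n, (1 / 2 : ℝ) ^ k := by rw [Finset.mul_sum]
      _ ≤ 2 * 2 := by gcongr; exact sum_geometric_two_le n
      _ = 4 := by norm_num
  · have h1 : ∫⁻ x, ∑' n, ‖(f - F n) x‖ₑ ∂(ω.measure μ) ≠ ∞ := by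
      rw [lintegral_tsum fun n => (hf.sub (hFm n)).1.enorm]
      simp_rw [← eLpNorm_one_eq_lintegral_enorm]
      refine ne_top_of_le_ne_top ?_ (ENNReal.tsum_le_tsum hF)
      rw [ENNReal.tsum_geometric]
      simp
    have h2 := ae_lt_top' (AEMeasurable.tsum fun n => (hf.sub (hFm n)).1.enorm) h1
    filter_upwards [ω.absolutelyContinuous' μ h2] with x hx
    have h3 := ENNReal.tendsto_atTop_zero_of_tsum_ne_top hx.ne
    rw [tendsto_iff_edist_tendsto_0]
    refine h3.congr fun n => ?_
    rw [edist_comm, edist_eq_enorm_sub]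
    rfl
  · refine tendsto_of_tendsto_of_tendsto_of_le_of_le tendsto_const_nhds
      (ENNReal.tendsto_pow_atTop_nhds_zero_of_lt_one (r := 2⁻¹) (by simp)) (fun _ => zero_le) ?_
    intro n
    simp only
    rw [eLpNorm_sub_comm]
    exact hF n

theorem conv_approx {f h : G → ℂ} (hf : MemLp f 1 (ω.measure μ))
    {F H : ℕ → G → ℂ} {S T : ℕ → G → ℝ} {M M' : ℝ} (hF : IsApprox μ ω f F S M)
    (hH : IsApprox μ ω h H T M') :
    (∀ᵐ x ∂(ω.measure μ), Integrable (fun y => f y * h (y⁻¹ * x)) μ) ∧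
    MemLp (groupConv μ f h) 1 (ω.measure μ) ∧
    Tendsto (fun n => eLpNorm (groupConv μ (F n) (H n) - groupConv μ f h) 1 (ω.measure μ)) atTop (𝓝 0) := by
  have hS0 : ∀ n x, 0 ≤ S n x := fun n x => (norm_nonneg _).trans (hF.le n x)
  have hT0 : ∀ n x, 0 ≤ T n x := fun n x => (norm_nonneg _).trans (hH.le n x)
  have hST0 : ∀ n x y, 0 ≤ S n y * T n (y⁻¹ * x) := fun n x y => mul_nonneg (hS0 _ _) (hT0 _ _)
  have hcont : ∀ n x, Continuous fun y => S n y * T n (y⁻¹ * x) := fun n x => by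
    have := hF.contS n
    have := hH.contS n
    fun_prop
  have hmono : ∀ x y, Monotone fun n => S n y * T n (y⁻¹ * x) := fun x y m n hmn =>
    mul_le_mul (hF.mono y hmn) (hH.mono _ hmn) (hT0 _ _) (hS0 _ _)
  -- the majorant
  let P : G → G → ℝ≥0∞ := fun x y => ⨆ n, ENNReal.ofReal (S n y * T n (y⁻¹ * x))
  have hPmeas : ∀ x, Measurable (P x) := fun x =>
    Measurable.iSup fun n => (hcont n x).measurable.ennreal_ofReal
  let r : ℕ → G → ℝ := fun n => groupConv μ (S n) (T n)
  have hr_cont : ∀ n, Continuous (r n) := fun n =>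
    conv_continuous μ (hF.contS n) (hF.suppS n) (hH.contS n)
  have hr_supp : ∀ n, HasCompactSupport (r n) := fun n =>
    conv_hasCompactSupport μ (hF.suppS n) (hH.suppS n)
  have hr0 : ∀ n x, 0 ≤ r n x := fun n x => integral_nonneg fun y => hST0 n x y
  have hr : ∀ n x, ∫⁻ y, ENNReal.ofReal (S n y * T n (y⁻¹ * x)) ∂μ = ENNReal.ofReal (r n x) := by
    intro n x
    rw [← ofReal_integral_eq_lintegral_ofReal
      (conv_integrable μ (hF.contS n) (hF.suppS n) (hH.contS n) x)
      (Eventually.of_forall fun y => hST0 n x y)]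
    rfl
  let Q : G → ℝ≥0∞ := fun x => ⨆ n, ENNReal.ofReal (r n x)
  have hQmeas : Measurable Q := Measurable.iSup fun n => (hr_cont n).measurable.ennreal_ofReal
  have hPQ : ∀ x, ∫⁻ y, P x y ∂μ = Q x := by
    intro x
    simp only [P, Q, ← hr]
    exact lintegral_iSup (fun n => (hcont n x).measurable.ennreal_ofReal)
      fun m n hmn y => ENNReal.ofReal_le_ofReal (hmono x y hmn)
  have hrmono : ∀ x, Monotone fun n => ENNReal.ofReal (r n x) := by
    intro x m n hmn
    simp only [← hr]
    exact lintegral_mono fun y => ENNReal.ofReal_le_ofReal (hmono x y hmn)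
  have hM : 0 ≤ M := (integral_nonneg (hS0 0)).trans (hF.bound 0)
  have hQ : ∫⁻ x, Q x ∂(ω.measure μ) ≤ ENNReal.ofReal (M * M') := by
    rw [lintegral_iSup (fun n => (hr_cont n).measurable.ennreal_ofReal)
      fun m n hmn x => hrmono x hmn]
    refine iSup_le fun n => ?_
    rw [← ofReal_integral_eq_lintegral_ofReal
      ((hr_cont n).integrable_of_hasCompactSupport (hr_supp n))
      (Eventually.of_forall fun x => hr0 n x)]
    refine ENNReal.ofReal_le_ofReal ((integral_conv_le μ ω (hF.contS n) (hF.suppS n) (hS0 n)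
      (hH.contS n) (hH.suppS n) (hT0 n)).trans ?_)
    exact mul_le_mul (hF.bound n) (hH.bound n) (integral_nonneg (hT0 n)) hM
  have hQtop : ∫⁻ x, Q x ∂(ω.measure μ) ≠ ∞ := ne_top_of_le_ne_top ENNReal.ofReal_ne_top hQ
  have hQae : ∀ᵐ x ∂(ω.measure μ), Q x < ∞ := ae_lt_top hQmeas hQtop
  obtain ⟨N, hNsub, hN, hN0⟩ := exists_measurable_superset_of_null (ae_iff.1 hH.ae)
  -- pointwise limits
  have hlim : ∀ x, Q x < ∞ → ∀ᵐ y ∂μ, P x y < ∞ ∧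
      Tendsto (fun n => F n y * H n (y⁻¹ * x)) atTop (𝓝 (f y * h (y⁻¹ * x))) := by
    intro x hx
    have hPae : ∀ᵐ y ∂μ, P x y < ∞ := ae_lt_top (hPmeas x) (by rw [hPQ]; exact hx.ne)
    filter_upwards [hPae, hF.ae, ae_inv_mul_notMem μ ω hf hN hN0 x] with y hy hfy hyN
    refine ⟨hy, ?_⟩
    by_cases h0 : f y = 0
    · rw [h0, zero_mul]
      rw [h0] at hfy
      by_cases hS : ∀ n, S n y = 0
      · have : ∀ n, F n y = 0 := fun n => norm_le_zero_iff.1 ((hF.le n y).trans_eq (hS n))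
        simp [this]
      · push Not at hS
        obtain ⟨m, hm⟩ := hS
        have hm' : 0 < S m y := lt_of_le_of_ne (hS0 m y) (Ne.symm hm)
        have hbd : ∀ n, m ≤ n → ‖H n (y⁻¹ * x)‖ ≤ (P x y).toReal / S m y := by
          intro n hn
          rw [le_div_iff₀ hm']
          have h1 : ENNReal.ofReal (S n y * T n (y⁻¹ * x)) ≤ P x y :=
            le_iSup (fun n => ENNReal.ofReal (S n y * T n (y⁻¹ * x))) n
          have h2 := (ENNReal.ofReal_le_iff_le_toReal hy.ne).1 h1
          refine le_trans ?_ h2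
          rw [mul_comm]
          exact mul_le_mul (hF.mono y hn) (hH.le n _) (norm_nonneg _) (hS0 _ _)
        refine squeeze_zero_norm' (a := fun n => ‖F n y‖ * ((P x y).toReal / S m y)) ?_ ?_
        · filter_upwards [eventually_ge_atTop m] with n hn
          rw [norm_mul]
          exact mul_le_mul_of_nonneg_left (hbd n hn) (norm_nonneg _)
        · simpa using hfy.norm.mul_const ((P x y).toReal / S m y)
    · have h1 : y⁻¹ * x ∉ N := hyN h0
      have h2 : Tendsto (fun n => H n (y⁻¹ * x)) atTop (𝓝 (h (y⁻¹ * x))) := by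
        by_contra h3
        exact h1 (hNsub h3)
      exact hfy.mul h2
  have hFH : ∀ n x y, P x y < ∞ → ‖F n y * H n (y⁻¹ * x)‖ ≤ (P x y).toReal := by
    intro n x y hy
    have h1 : ENNReal.ofReal (S n y * T n (y⁻¹ * x)) ≤ P x y :=
      le_iSup (fun n => ENNReal.ofReal (S n y * T n (y⁻¹ * x))) n
    have h2 := (ENNReal.ofReal_le_iff_le_toReal hy.ne).1 h1
    rw [norm_mul]
    exact (mul_le_mul (hF.le n y) (hH.le n _) (norm_nonneg _) (hS0 _ _)).trans h2
  have hPint : ∀ x, Q x < ∞ → Integrable (fun y => (P x y).toReal) μ := fun x hx =>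
    integrable_toReal_of_lintegral_ne_top (hPmeas x).aemeasurable (by rw [hPQ]; exact hx.ne)
  have hFHm : ∀ n x, AEStronglyMeasurable (fun y => F n y * H n (y⁻¹ * x)) μ := fun n x =>
    (conv_integrable μ (hF.cont n) (hF.supp n) (hH.cont n) x).1
  have hint : ∀ x, Q x < ∞ → Integrable (fun y => f y * h (y⁻¹ * x)) μ := by
    intro x hx
    refine (hPint x hx).mono' (aestronglyMeasurable_of_tendsto_ae atTop (fun n => hFHm n x)
      ((hlim x hx).mono fun y hy => hy.2)) ?_
    filter_upwards [hlim x hx] with y hy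
    exact le_of_tendsto hy.2.norm (Eventually.of_forall fun n => hFH n x y hy.1)
  have hconv : ∀ x, Q x < ∞ →
      Tendsto (fun n => groupConv μ (F n) (H n) x) atTop (𝓝 (groupConv μ f h x)) := by
    intro x hx
    refine tendsto_integral_of_dominated_convergence (fun y => (P x y).toReal)
      (fun n => hFHm n x) (hPint x hx) (fun n => ?_) ((hlim x hx).mono fun y hy => hy.2)
    filter_upwards [hlim x hx] with y hy
    exact hFH n x y hy.1
  have hbound : ∀ n x, Q x < ∞ → ‖groupConv μ (F n) (H n) x‖ ≤ (Q x).toReal := by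
    intro n x hx
    rw [← hPQ x, ← integral_toReal (hPmeas x).aemeasurable ((hlim x hx).mono fun y hy => hy.1)]
    refine norm_integral_le_of_norm_le (hPint x hx) ?_
    filter_upwards [hlim x hx] with y hy
    exact hFH n x y hy.1
  have hQint : Integrable (fun x => (Q x).toReal) (ω.measure μ) :=
    integrable_toReal_of_lintegral_ne_top hQmeas.aemeasurable hQtop
  have hcm : ∀ n, AEStronglyMeasurable (groupConv μ (F n) (H n)) (ω.measure μ) := fun n =>
    (conv_continuous μ (hF.cont n) (hF.supp n) (hH.cont n)).aestronglyMeasurable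
  have hm : AEStronglyMeasurable (groupConv μ f h) (ω.measure μ) :=
    aestronglyMeasurable_of_tendsto_ae atTop hcm (hQae.mono fun x hx => hconv x hx)
  refine ⟨hQae.mono fun x hx => hint x hx, ?_, ?_⟩
  · refine memLp_one_iff_integrable.2 (hQint.mono' hm (hQae.mono fun x hx => ?_))
    exact le_of_tendsto (hconv x hx).norm (Eventually.of_forall fun n => hbound n x hx)
  · simp_rw [eLpNorm_one_eq_lintegral_enorm]
    have := tendsto_lintegral_norm_of_dominated_convergence hcm hQint.hasFiniteIntegral
      (fun n => hQae.mono fun x hx => hbound n x hx) (hQae.mono fun x hx => hconv x hx)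
    simpa only [Pi.sub_apply, ofReal_norm] using this

end approx

section convL1

variable {G : Type*} [Group G] [TopologicalSpace G] [IsTopologicalGroup G] [LocallyCompactSpace G]
  [T2Space G] [MeasurableSpace G] [BorelSpace G]
  (μ : Measure G) [μ.IsHaarMeasure] [μ.Regular] (ω : Weight G)

theorem memLp_conv {f h : G → ℂ} (hf : MemLp f 1 (ω.measure μ)) (hh : MemLp h 1 (ω.measure μ)) :
    MemLp (groupConv μ f h) 1 (ω.measure μ) := by
  obtain ⟨F, S, M, hF⟩ := exists_isApprox μ ω hf
  obtain ⟨H, T, M', hH⟩ := exists_isApprox μ ω hh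
  exact (conv_approx μ ω hf hF hH).2.1

theorem ae_integrable_conv {f h : G → ℂ} (hf : MemLp f 1 (ω.measure μ))
    (hh : MemLp h 1 (ω.measure μ)) :
    ∀ᵐ x ∂(ω.measure μ), Integrable (fun y => f y * h (y⁻¹ * x)) μ := by
  obtain ⟨F, S, M, hF⟩ := exists_isApprox μ ω hf
  obtain ⟨H, T, M', hH⟩ := exists_isApprox μ ω hh
  exact (conv_approx μ ω hf hF hH).1

theorem conv_congr {f f' h h' : G → ℂ} (hf : MemLp f 1 (ω.measure μ)) (hff : f =ᵐ[μ] f')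
    (hhh : h =ᵐ[μ] h') : groupConv μ f h = groupConv μ f' h' := by
  funext x
  obtain ⟨N, hNsub, hN, hN0⟩ := exists_measurable_superset_of_null (ae_iff.1 hhh)
  refine integral_congr_ae ?_
  filter_upwards [hff, ae_inv_mul_notMem μ ω hf hN hN0 x] with y hy hyN
  rw [← hy]
  by_cases h0 : f y = 0
  · simp [h0]
  · have : h (y⁻¹ * x) = h' (y⁻¹ * x) := by
      by_contra h3
      exact hyN h0 (hNsub h3)
    rw [this]

theorem eLpNorm_conv_le_of_continuous {F H : G → ℂ} (hF : Continuous F)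
    (hF' : HasCompactSupport F) (hH : Continuous H) (hH' : HasCompactSupport H) :
    eLpNorm (groupConv μ F H) 1 (ω.measure μ) ≤
      eLpNorm F 1 (ω.measure μ) * eLpNorm H 1 (ω.measure μ) := by
  have key : ∀ {K : G → ℂ}, Continuous K → HasCompactSupport K →
      eLpNorm K 1 (ω.measure μ) = ENNReal.ofReal (∫ x, ‖K x‖ ∂(ω.measure μ)) := by
    intro K hK hK'
    rw [eLpNorm_one_eq_lintegral_enorm, ofReal_integral_norm_eq_lintegral_enorm
      (hK.integrable_of_hasCompactSupport hK')]
  have hc := conv_continuous μ hF hF' hH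
  have hs := conv_hasCompactSupport μ hF' hH'
  rw [key hc hs, key hF hF', key hH hH', ← ENNReal.ofReal_mul (integral_nonneg fun x => norm_nonneg _)]
  refine ENNReal.ofReal_le_ofReal (le_trans ?_ (integral_conv_le μ ω hF.norm hF'.norm
    (fun x => norm_nonneg _) hH.norm hH'.norm fun x => norm_nonneg _))
  refine integral_mono (hc.norm.integrable_of_hasCompactSupport hs.norm)
    ((conv_continuous μ hF.norm hF'.norm hH.norm).integrable_of_hasCompactSupport
      (conv_hasCompactSupport μ hF'.norm hH'.norm)) fun x => ?_
  refine (norm_integral_le_integral_norm _).trans_eq ?_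
  simp only [norm_mul]
  rfl

theorem IsApprox.tendsto_eLpNorm {μ : Measure G} [μ.IsHaarMeasure] [μ.Regular] {ω : Weight G}
    {f : G → ℂ} (hf : MemLp f 1 (ω.measure μ)) {F : ℕ → G → ℂ} {S : ℕ → G → ℝ} {M : ℝ}
    (hF : IsApprox μ ω f F S M) :
    Tendsto (fun n => eLpNorm (F n) 1 (ω.measure μ)) atTop (𝓝 (eLpNorm f 1 (ω.measure μ))) := by
  have hFm : ∀ n, AEStronglyMeasurable (F n) (ω.measure μ) := fun n =>
    (hF.cont n).aestronglyMeasurable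
  have h1 := hF.lim
  have hne : eLpNorm f 1 (ω.measure μ) ≠ ∞ := hf.2.ne
  have hup : Tendsto (fun n => eLpNorm f 1 (ω.measure μ) + eLpNorm (F n - f) 1 (ω.measure μ)) atTop
      (𝓝 (eLpNorm f 1 (ω.measure μ))) := by
    simpa using h1.const_add (eLpNorm f 1 (ω.measure μ))
  have hlo : Tendsto (fun n => eLpNorm f 1 (ω.measure μ) - eLpNorm (F n - f) 1 (ω.measure μ)) atTop
      (𝓝 (eLpNorm f 1 (ω.measure μ))) := by
    simpa using ENNReal.Tendsto.sub tendsto_const_nhds h1 (Or.inl hne)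
  refine tendsto_of_tendsto_of_tendsto_of_le_of_le hlo hup (fun n => ?_) fun n => ?_
  · simp only
    rw [tsub_le_iff_right, eLpNorm_sub_comm]
    calc _ = eLpNorm (F n + (f - F n)) 1 (ω.measure μ) := by rw [add_sub_cancel]
      _ ≤ _ := eLpNorm_add_le (hFm n) (hf.1.sub (hFm n)) le_rfl
  · calc _ = eLpNorm (f + (F n - f)) 1 (ω.measure μ) := by rw [add_sub_cancel]
      _ ≤ _ := eLpNorm_add_le hf.1 ((hFm n).sub hf.1) le_rfl

theorem eLpNorm_conv_le {f h : G → ℂ} (hf : MemLp f 1 (ω.measure μ))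
    (hh : MemLp h 1 (ω.measure μ)) :
    eLpNorm (groupConv μ f h) 1 (ω.measure μ) ≤
      eLpNorm f 1 (ω.measure μ) * eLpNorm h 1 (ω.measure μ) := by
  obtain ⟨F, S, M, hF⟩ := exists_isApprox μ ω hf
  obtain ⟨H, T, M', hH⟩ := exists_isApprox μ ω hh
  obtain ⟨-, hm, hlim⟩ := conv_approx μ ω hf hF hH
  have h1 : Tendsto (fun n => eLpNorm (groupConv μ (F n) (H n) - groupConv μ f h) 1 (ω.measure μ) +
      eLpNorm (F n) 1 (ω.measure μ) * eLpNorm (H n) 1 (ω.measure μ)) atTop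
      (𝓝 (0 + eLpNorm f 1 (ω.measure μ) * eLpNorm h 1 (ω.measure μ))) :=
    hlim.add (ENNReal.Tendsto.mul (hF.tendsto_eLpNorm hf) (Or.inr hh.2.ne)
      (hH.tendsto_eLpNorm hh) (Or.inr hf.2.ne))
  rw [zero_add] at h1
  refine ge_of_tendsto' h1 fun n => ?_
  have hc := (conv_continuous μ (hF.cont n) (hF.supp n) (hH.cont n)).aestronglyMeasurable
    (μ := ω.measure μ)
  calc _ = eLpNorm ((groupConv μ f h - groupConv μ (F n) (H n)) + groupConv μ (F n) (H n)) 1 (ω.measure μ) := by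
        rw [sub_add_cancel]
    _ ≤ _ := eLpNorm_add_le (hm.1.sub hc) hc le_rfl
    _ ≤ _ := by
        rw [eLpNorm_sub_comm]
        exact add_le_add le_rfl (eLpNorm_conv_le_of_continuous μ ω (hF.cont n) (hF.supp n)
          (hH.cont n) (hH.supp n))

end convL1

/-- The Beurling algebra `L¹(G, ω)`, with the norm `∫ |f(x)| ω(x) dx`. -/
def BeurlingAlgebra {G : Type*} [Group G] [MeasurableSpace G] (μ : Measure G) (ω : Weight G) :
    Type _ := Lp ℂ 1 (ω.measure μ)

namespace BeurlingAlgebra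

section basic

variable {G : Type*} [Group G] [MeasurableSpace G] (μ : Measure G) (ω : Weight G)

noncomputable instance : NormedAddCommGroup (BeurlingAlgebra μ ω) :=
  inferInstanceAs (NormedAddCommGroup (Lp ℂ 1 (ω.measure μ)))

noncomputable instance : NormedSpace ℂ (BeurlingAlgebra μ ω) :=
  inferInstanceAs (NormedSpace ℂ (Lp ℂ 1 (ω.measure μ)))

instance : CompleteSpace (BeurlingAlgebra μ ω) :=
  inferInstanceAs (CompleteSpace (Lp ℂ 1 (ω.measure μ)))

variable {μ ω}

/-- A representative of a class of functions. -/
noncomputable def toFun (f : BeurlingAlgebra μ ω) : G → ℂ :=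
  (show Lp ℂ 1 (ω.measure μ) from f : G → ℂ)

noncomputable instance : CoeFun (BeurlingAlgebra μ ω) (fun _ => G → ℂ) := ⟨toFun⟩

/-- The class of a function with `∫ |f(x)| ω(x) dx < ∞`. -/
noncomputable def mk (f : G → ℂ) (hf : MemLp f 1 (ω.measure μ)) : BeurlingAlgebra μ ω :=
  hf.toLp f

theorem memLp (f : BeurlingAlgebra μ ω) : MemLp f 1 (ω.measure μ) := Lp.memLp f

theorem coeFn_mk {f : G → ℂ} (hf : MemLp f 1 (ω.measure μ)) : mk f hf =ᵐ[ω.measure μ] f :=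
  hf.coeFn_toLp

theorem ext_ae {f h : BeurlingAlgebra μ ω} (H : f =ᵐ[ω.measure μ] h) : f = h := Lp.ext H

theorem ae_haar {f h : G → ℂ} (H : f =ᵐ[ω.measure μ] h) : f =ᵐ[μ] h :=
  (ω.absolutelyContinuous' μ).ae_eq H

theorem ae_measure {f h : G → ℂ} (H : f =ᵐ[μ] h) : f =ᵐ[ω.measure μ] h :=
  (ω.absolutelyContinuous μ).ae_eq H

theorem norm_eq (f : BeurlingAlgebra μ ω) : ‖f‖ = (eLpNorm f 1 (ω.measure μ)).toReal :=
  Lp.norm_def f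

theorem norm_eq_integral (f : BeurlingAlgebra μ ω) : ‖f‖ = ∫ x, ‖f x‖ * ω x ∂μ := by
  rw [norm_eq, eLpNorm_one_eq_lintegral_enorm, ← integral_norm_eq_lintegral_enorm f.memLp.1,
    ω.integral_measure]
  simp [mul_comm]

theorem coeFn_add (f h : BeurlingAlgebra μ ω) : ⇑(f + h) =ᵐ[ω.measure μ] f + h := Lp.coeFn_add f h

theorem coeFn_sub (f h : BeurlingAlgebra μ ω) : ⇑(f - h) =ᵐ[ω.measure μ] f - h := Lp.coeFn_sub f h

theorem coeFn_smul (c : ℂ) (f : BeurlingAlgebra μ ω) : ⇑(c • f) =ᵐ[ω.measure μ] c • f :=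
  Lp.coeFn_smul c f

theorem coeFn_zero : ⇑(0 : BeurlingAlgebra μ ω) =ᵐ[ω.measure μ] 0 := Lp.coeFn_zero ℂ 1 _

end basic

variable {G : Type*} [Group G] [TopologicalSpace G] [IsTopologicalGroup G] [LocallyCompactSpace G]
  [T2Space G] [MeasurableSpace G] [BorelSpace G]
  {μ : Measure G} [μ.IsHaarMeasure] [μ.Regular] {ω : Weight G}

/-- The product of `L¹(G, ω)` is the convolution product. -/
noncomputable instance : Mul (BeurlingAlgebra μ ω) where
  mul f h := mk (groupConv μ f h) (memLp_conv μ ω f.memLp h.memLp)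

theorem coeFn_mul (f h : BeurlingAlgebra μ ω) : ⇑(f * h) =ᵐ[ω.measure μ] groupConv μ f h :=
  coeFn_mk (memLp_conv μ ω f.memLp h.memLp)

theorem mk_mul_mk {f h : G → ℂ} (hf : MemLp f 1 (ω.measure μ)) (hh : MemLp h 1 (ω.measure μ)) :
    mk f hf * mk h hh = mk (groupConv μ f h) (memLp_conv μ ω hf hh) := by
  refine ext_ae ((coeFn_mul _ _).trans ?_)
  rw [conv_congr μ ω (mk f hf).memLp (ae_haar (coeFn_mk hf)) (ae_haar (coeFn_mk hh))]
  exact (coeFn_mk _).symm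

theorem norm_mul_le' (f h : BeurlingAlgebra μ ω) : ‖f * h‖ ≤ ‖f‖ * ‖h‖ := by
  rw [norm_eq, norm_eq, norm_eq, ← ENNReal.toReal_mul, eLpNorm_congr_ae (coeFn_mul f h)]
  exact ENNReal.toReal_mono (ENNReal.mul_ne_top f.memLp.2.ne h.memLp.2.ne)
    (eLpNorm_conv_le μ ω f.memLp h.memLp)

theorem add_mul' (f g h : BeurlingAlgebra μ ω) : (f + g) * h = f * h + g * h := by
  refine ext_ae ((coeFn_mul _ _).trans (EventuallyEq.trans ?_ (coeFn_add _ _).symm))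
  rw [conv_congr μ ω (f + g).memLp (ae_haar (coeFn_add f g)) (EventuallyEq.refl _ h)]
  filter_upwards [coeFn_mul f h, coeFn_mul g h, ae_integrable_conv μ ω f.memLp h.memLp,
    ae_integrable_conv μ ω g.memLp h.memLp] with x h1 h2 h3 h4
  simp only [Pi.add_apply, h1, h2, groupConv, add_mul]
  exact integral_add h3 h4

theorem mul_add' (f g h : BeurlingAlgebra μ ω) : f * (g + h) = f * g + f * h := by
  refine ext_ae ((coeFn_mul _ _).trans (EventuallyEq.trans ?_ (coeFn_add _ _).symm))
  rw [conv_congr μ ω f.memLp (EventuallyEq.refl _ f) (ae_haar (coeFn_add g h))]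
  filter_upwards [coeFn_mul f g, coeFn_mul f h, ae_integrable_conv μ ω f.memLp g.memLp,
    ae_integrable_conv μ ω f.memLp h.memLp] with x h1 h2 h3 h4
  simp only [Pi.add_apply, h1, h2, groupConv, mul_add]
  exact integral_add h3 h4

theorem smul_mul' (c : ℂ) (f h : BeurlingAlgebra μ ω) : (c • f) * h = c • (f * h) := by
  refine ext_ae ((coeFn_mul _ _).trans (EventuallyEq.trans ?_ (coeFn_smul _ _).symm))
  rw [conv_congr μ ω (c • f).memLp (ae_haar (coeFn_smul c f)) (EventuallyEq.refl _ h)]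
  filter_upwards [coeFn_mul f h] with x h1
  simp only [Pi.smul_apply, smul_eq_mul, h1, groupConv, mul_assoc]
  exact integral_const_mul _ _

theorem mul_smul' (c : ℂ) (f h : BeurlingAlgebra μ ω) : f * (c • h) = c • (f * h) := by
  refine ext_ae ((coeFn_mul _ _).trans (EventuallyEq.trans ?_ (coeFn_smul _ _).symm))
  rw [conv_congr μ ω f.memLp (EventuallyEq.refl _ f) (ae_haar (coeFn_smul c h))]
  filter_upwards [coeFn_mul f h] with x h1
  simp only [Pi.smul_apply, smul_eq_mul, h1, groupConv, mul_left_comm _ c]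
  exact integral_const_mul _ _

/-- Convolution as a bounded bilinear map. -/
noncomputable def mulCLM : BeurlingAlgebra μ ω →L[ℂ] BeurlingAlgebra μ ω →L[ℂ] BeurlingAlgebra μ ω :=
  LinearMap.mkContinuous₂ (LinearMap.mk₂ ℂ (fun f h => f * h) add_mul' smul_mul' mul_add' mul_smul')
    1 fun f h => by simpa using norm_mul_le' f h

theorem mulCLM_apply (f h : BeurlingAlgebra μ ω) : mulCLM f h = f * h := rfl

instance : ContinuousMul (BeurlingAlgebra μ ω) := ⟨by
  have h1 : Continuous fun p : BeurlingAlgebra μ ω × BeurlingAlgebra μ ω => mulCLM p.1 p.2 :=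
    (mulCLM (μ := μ) (ω := ω)).continuous₂
  simp only [mulCLM_apply] at h1
  exact h1⟩

theorem tendsto_mul {f h : BeurlingAlgebra μ ω} {F H : ℕ → BeurlingAlgebra μ ω}
    (hF : Tendsto F atTop (𝓝 f)) (hH : Tendsto H atTop (𝓝 h)) :
    Tendsto (fun n => F n * H n) atTop (𝓝 (f * h)) := hF.mul hH

theorem exists_seq (f : BeurlingAlgebra μ ω) :
    ∃ (F : ℕ → G → ℂ) (hF : ∀ n, MemLp (F n) 1 (ω.measure μ)), (∀ n, Continuous (F n)) ∧
      (∀ n, HasCompactSupport (F n)) ∧ Tendsto (fun n => mk (F n) (hF n)) atTop (𝓝 f) := by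
  obtain ⟨F, S, M, hF⟩ := exists_isApprox μ ω f.memLp
  have hm : ∀ n, MemLp (F n) 1 (ω.measure μ) := fun n => memLp_one_iff_integrable.2
    ((hF.cont n).integrable_of_hasCompactSupport (hF.supp n))
  refine ⟨F, hm, hF.cont, hF.supp, ?_⟩
  rw [tendsto_iff_norm_sub_tendsto_zero]
  have := (ENNReal.tendsto_toReal ENNReal.zero_ne_top).comp hF.lim
  rw [ENNReal.toReal_zero] at this
  refine this.congr fun n => ?_
  rw [norm_eq, Function.comp_apply]
  congr 1
  refine eLpNorm_congr_ae ?_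
  filter_upwards [coeFn_sub (mk (F n) (hm n)) f, coeFn_mk (hm n)] with x h1 h2
  simp only [Pi.sub_apply] at h1 ⊢
  rw [h1, h2]

theorem mul_assoc' (f g h : BeurlingAlgebra μ ω) : f * g * h = f * (g * h) := by
  obtain ⟨F, hF, hFc, hFs, hFl⟩ := exists_seq f
  obtain ⟨K, hK, hKc, hKs, hKl⟩ := exists_seq g
  obtain ⟨H, hH, hHc, hHs, hHl⟩ := exists_seq h
  refine tendsto_nhds_unique (tendsto_mul (tendsto_mul hFl hKl) hHl)
    ((tendsto_mul hFl (tendsto_mul hKl hHl)).congr fun n => ?_)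
  simp only [mk_mul_mk]
  congr 1
  exact (conv_assoc_of_continuous μ (hFc n) (hFs n) (hKc n) (hKs n) (hHc n)).symm

noncomputable instance : NonUnitalNormedRing (BeurlingAlgebra μ ω) where
  __ := (inferInstance : NormedAddCommGroup (BeurlingAlgebra μ ω))
  mul := (· * ·)
  left_distrib := mul_add'
  right_distrib := add_mul'
  zero_mul f := by
    have := smul_mul' 0 f f
    rwa [zero_smul, zero_smul] at this
  mul_zero f := by
    have := mul_smul' 0 f f
    rwa [zero_smul, zero_smul] at this
  mul_assoc := mul_assoc'
  norm_mul_le := norm_mul_le'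

instance : IsScalarTower ℂ (BeurlingAlgebra μ ω) (BeurlingAlgebra μ ω) := ⟨smul_mul'⟩

instance : SMulCommClass ℂ (BeurlingAlgebra μ ω) (BeurlingAlgebra μ ω) :=
  ⟨fun c f h => (mul_smul' c f h).symm⟩

end BeurlingAlgebra

namespace Weight

section radius

variable {G : Type*} [Group G] [MeasurableSpace G] (ω : Weight G)

theorem subadditive_log (x : G) : Subadditive fun n => Real.log (ω (x ^ n)) := fun m n => by
  simp only
  rw [pow_add, ← Real.log_mul (ω.pos _).ne' (ω.pos _).ne']
  exact Real.log_le_log (ω.pos _) (ω.mul_le _ _)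

theorem bddBelow_log (x : G) : BddBelow (Set.range fun n : ℕ => Real.log (ω (x ^ n)) / n) := by
  refine ⟨min 0 (-Real.log (ω x⁻¹)), ?_⟩
  rintro _ ⟨n, rfl⟩
  rcases Nat.eq_zero_or_pos n with rfl | hn
  · simp
  refine (min_le_right _ _).trans ?_
  have h1 : ∀ m : ℕ, 0 < m → Real.log (ω (x⁻¹ ^ m)) ≤ m * Real.log (ω x⁻¹) := by
    intro m hm
    induction m, hm using Nat.le_induction with
    | base => simp
    | succ k _ ih =>
      have := ω.subadditive_log x⁻¹ k 1
      simp only [pow_one] at this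
      push_cast
      linarith
  have h2 := Real.log_nonneg (ω.inv_bound (x ^ n))
  rw [Real.log_mul (ω.pos _).ne' (ω.pos _).ne', ← inv_pow] at h2
  rw [le_div_iff₀ (by exact_mod_cast hn)]
  linarith [h1 n hn]

/-- The logarithm of the spectral radius of `x` with respect to `ω`. -/
noncomputable def logRadius (x : G) : ℝ := (ω.subadditive_log x).lim

theorem tendsto_logRadius (x : G) :
    Tendsto (fun n : ℕ => Real.log (ω (x ^ n)) / n) atTop (𝓝 (ω.logRadius x)) :=
  (ω.subadditive_log x).tendsto_lim (ω.bddBelow_log x)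

theorem exp_logRadius_le (x : G) : Real.exp (ω.logRadius x) ≤ ω x := by
  rw [← Real.le_log_iff_exp_le (ω.pos x)]
  have h := (ω.subadditive_log x).lim_le_div (ω.bddBelow_log x) one_ne_zero
  simp only [pow_one, Nat.cast_one, div_one] at h
  exact h

theorem logRadius_conj (g x : G) : ω.logRadius (g⁻¹ * x * g) = ω.logRadius x := by
  have key : ∀ g x : G, ω.logRadius (g⁻¹ * x * g) ≤ ω.logRadius x := by
    intro g x
    have h1 : Tendsto (fun n : ℕ => (Real.log (ω g⁻¹) + Real.log (ω g)) / n +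
        Real.log (ω (x ^ n)) / n) atTop (𝓝 (0 + ω.logRadius x)) :=
      (tendsto_const_div_atTop_nhds_zero_nat _).add (ω.tendsto_logRadius x)
    rw [zero_add] at h1
    refine le_of_tendsto_of_tendsto' (ω.tendsto_logRadius _) h1 fun n => ?_
    rw [← add_div]
    refine div_le_div_of_nonneg_right ?_ (Nat.cast_nonneg n)
    have h2 : (g⁻¹ * x * g) ^ n = g⁻¹ * x ^ n * g := by
      simpa using conj_pow (i := n) (a := g⁻¹) (b := x)
    rw [h2, ← Real.log_mul (ω.pos _).ne' (ω.pos _).ne',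
      ← Real.log_mul (mul_pos (ω.pos _) (ω.pos _)).ne' (ω.pos _).ne']
    refine Real.log_le_log (ω.pos _) ((ω.mul_le _ _).trans ?_)
    have := mul_le_mul_of_nonneg_right (ω.mul_le g⁻¹ (x ^ n)) (ω.pos g).le
    linarith
  refine le_antisymm (key g x) ?_
  have := key g⁻¹ (g⁻¹ * x * g)
  simpa [mul_assoc] using this

end radius

theorem measurable_logRadius {G : Type*} [Group G] [TopologicalSpace G] [IsTopologicalGroup G]
    [MeasurableSpace G] [BorelSpace G] (ω : Weight G) : Measurable ω.logRadius :=
  measurable_of_tendsto_metrizable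
    (f := fun (n : ℕ) x => Real.log (ω (x ^ n)) / n)
    (fun n => (Real.measurable_log.comp (ω.meas.comp (continuous_pow n).measurable)).div_const _)
    (tendsto_pi_nhds.2 fun x => ω.tendsto_logRadius x)

end Weight

section conj

variable {G : Type*} [Group G] [TopologicalSpace G] [IsTopologicalGroup G] [LocallyCompactSpace G]
  [T2Space G] [MeasurableSpace G] [BorelSpace G]

/-- Conjugation `x ↦ g⁻¹ x g`. -/
def conjEquiv (g : G) : G ≃ᵐ G := ((Homeomorph.mulLeft g⁻¹).trans (Homeomorph.mulRight g)).toMeasurableEquiv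

theorem conjEquiv_apply (g x : G) : conjEquiv g x = g⁻¹ * x * g := rfl

variable (μ : Measure G) [μ.IsHaarMeasure] [μ.Regular]

theorem exists_map_conj (g : G) : ∃ c : ℝ≥0, μ.map (conjEquiv g) = c • μ := by
  have h1 : μ.map (conjEquiv g) = μ.map (· * g) := by
    have : (conjEquiv g : G → G) = (· * g) ∘ (g⁻¹ * ·) := rfl
    rw [this, ← Measure.map_map (measurable_mul_const g) (measurable_const_mul g⁻¹),
      map_mul_left_eq_self]
  have : (μ.map (· * g)).Regular := Measure.Regular.map (Homeomorph.mulRight g)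
  exact ⟨_, h1.trans (Measure.isMulLeftInvariant_eq_smul_of_regular _ μ)⟩

end conj

namespace BeurlingAlgebra

variable {G : Type*} [Group G] [TopologicalSpace G] [IsTopologicalGroup G] [LocallyCompactSpace G]
  [T2Space G] [MeasurableSpace G] [BorelSpace G]
  {μ : Measure G} [μ.IsHaarMeasure] [μ.Regular] {ω : Weight G}

/-- `f` is invariant under all inner automorphisms. -/
def IsCentral (f : BeurlingAlgebra μ ω) : Prop :=
  ∀ g : G, (fun x => f (g⁻¹ * x * g)) =ᵐ[μ] f

/-- If `L¹(G, ω)` has a nonzero conjugation-invariant element, then inner automorphisms preserve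
the Haar measure. -/
theorem map_conj_eq_self {f : BeurlingAlgebra μ ω} (hf : IsCentral f) (h0 : f ≠ 0) (g : G) :
    μ.map (conjEquiv g) = μ := by
  obtain ⟨c, hc⟩ := exists_map_conj μ g
  let φ : G → ℝ≥0∞ := fun x => ‖f x‖ₑ * ENNReal.ofReal (Real.exp (ω.logRadius x))
  have hφ : (fun x => φ (conjEquiv g x)) =ᵐ[μ] φ := by
    filter_upwards [hf g] with x hx
    simp only [φ, conjEquiv_apply, ω.logRadius_conj, hx]
  have hfin : ∫⁻ x, φ x ∂μ ≠ ∞ := by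
    have h1 := f.memLp.2
    rw [eLpNorm_one_eq_lintegral_enorm, ω.lintegral_measure] at h1
    refine ((lintegral_mono fun x => ?_).trans_lt h1).ne
    simp only [φ]
    rw [mul_comm]
    gcongr
    exact ω.exp_logRadius_le x
  have hfm : AEStronglyMeasurable f μ := f.memLp.1.mono_ac (ω.absolutelyContinuous' μ)
  have hne : ∫⁻ x, φ x ∂μ ≠ 0 := by
    intro h
    have hφm : AEMeasurable φ μ := hfm.enorm.mul
      (ω.measurable_logRadius.exp.ennreal_ofReal).aemeasurable
    rw [lintegral_eq_zero_iff' hφm] at h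
    apply h0
    refine ext_ae (ae_measure (EventuallyEq.trans ?_ (ae_haar coeFn_zero).symm))
    filter_upwards [h] with x hx
    have h3 : ENNReal.ofReal (Real.exp (ω.logRadius x)) ≠ 0 :=
      (ENNReal.ofReal_pos.2 (Real.exp_pos _)).ne'
    simpa [φ, h3, Real.exp_pos] using hx
  have h1 : ∫⁻ x, φ x ∂μ = c * ∫⁻ x, φ x ∂μ := by
    calc ∫⁻ x, φ x ∂μ = ∫⁻ x, φ (conjEquiv g x) ∂μ := (lintegral_congr_ae hφ).symm
      _ = ∫⁻ x, φ x ∂(μ.map (conjEquiv g)) := (lintegral_map_equiv _ _).symm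
      _ = c * ∫⁻ x, φ x ∂μ := by
        rw [hc, lintegral_smul_measure]
        rfl
  have h2 : (c : ℝ≥0∞) = 1 := by
    have h3 : 1 * ∫⁻ x, φ x ∂μ = c * ∫⁻ x, φ x ∂μ := by rw [one_mul]; exact h1
    exact ((ENNReal.mul_left_inj hne hfin).1 h3).symm
  rw [hc, ENNReal.coe_eq_one.1 h2, one_smul]

theorem ae_conj {p : G → Prop} (g : G) (hp : ∀ᵐ x ∂μ, p x) : ∀ᵐ x ∂μ, p (g⁻¹ * x * g) := by
  obtain ⟨c, hc⟩ := exists_map_conj μ g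
  have : Measure.QuasiMeasurePreserving (conjEquiv g) μ μ :=
    ⟨(conjEquiv g).measurable, by rw [hc]; exact Measure.smul_absolutelyContinuous⟩
  exact this.ae hp

theorem isCentral_of_ae {f : BeurlingAlgebra μ ω} {k : G → ℂ} (hfk : f =ᵐ[ω.measure μ] k)
    (hk : ∀ g, (fun x => k (g⁻¹ * x * g)) =ᵐ[μ] k) : IsCentral f := fun g => by
  filter_upwards [ae_haar hfk, ae_conj g (ae_haar hfk), hk g] with x h1 h2 h3
  rw [h1, h2, h3]

theorem isCentral_zero : IsCentral (0 : BeurlingAlgebra μ ω) :=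
  isCentral_of_ae coeFn_zero fun _ => EventuallyEq.refl _ _

theorem IsCentral.add {f h : BeurlingAlgebra μ ω} (hf : IsCentral f) (hh : IsCentral h) :
    IsCentral (f + h) := by
  refine isCentral_of_ae (coeFn_add f h) fun g => ?_
  filter_upwards [hf g, hh g] with x h1 h2
  simp only [Pi.add_apply]
  rw [h1, h2]

theorem IsCentral.smul {f : BeurlingAlgebra μ ω} (c : ℂ) (hf : IsCentral f) :
    IsCentral (c • f) := by
  refine isCentral_of_ae (coeFn_smul c f) fun g => ?_
  filter_upwards [hf g] with x h1
  simp only [Pi.smul_apply]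
  rw [h1]

theorem IsCentral.mul {f h : BeurlingAlgebra μ ω} (hf : IsCentral f) (hh : IsCentral h) :
    IsCentral (f * h) := by
  rcases eq_or_ne f 0 with rfl | h0
  · rw [zero_mul]
    exact hf
  refine isCentral_of_ae (coeFn_mul f h) fun g => Eventually.of_forall fun x => ?_
  have hmap := map_conj_eq_self hf h0 g
  simp only
  conv_rhs => rw [conv_congr μ ω f.memLp (hf g).symm (hh g).symm]
  unfold groupConv
  have h1 := integral_map_equiv (μ := μ) (conjEquiv g) fun y => f y * h (y⁻¹ * (g⁻¹ * x * g))
  rw [hmap] at h1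
  rw [h1]
  congr 1 with y
  simp only [conjEquiv_apply]
  congr 2
  group

section comm

theorem lintegral_conj_sub_le [μ.IsMulRightInvariant] {f : BeurlingAlgebra μ ω} (hf : IsCentral f)
    {F : G → ℂ} (hF : Continuous F) (z : G) :
    ∫⁻ x, ‖F (x * z⁻¹) - F (z⁻¹ * x)‖ₑ ∂(ω.measure μ) ≤
      2 * (ENNReal.ofReal (ω z) * eLpNorm (F - ⇑f) 1 (ω.measure μ)) := by
  let k : G → ℝ≥0∞ := fun x => ‖(F - ⇑f) x‖ₑ
  have hk : ∫⁻ x, ENNReal.ofReal (ω x) * k x ∂μ = eLpNorm (F - ⇑f) 1 (ω.measure μ) := by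
    rw [eLpNorm_one_eq_lintegral_enorm, ω.lintegral_measure]
  have hr : ∫⁻ x, ENNReal.ofReal (ω x) * k (x * z⁻¹) ∂μ ≤
      ENNReal.ofReal (ω z) * eLpNorm (F - ⇑f) 1 (ω.measure μ) := by
    rw [← lintegral_mul_right_eq_self _ z, ← hk, ← lintegral_const_mul' _ _ ENNReal.ofReal_ne_top]
    refine lintegral_mono fun x => ?_
    simp only [mul_inv_cancel_right, ← mul_assoc]
    rw [← ENNReal.ofReal_mul (ω.pos z).le]
    gcongr
    rw [mul_comm (ω z)]
    exact ω.mul_le _ _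
  have hl : ∫⁻ x, ENNReal.ofReal (ω x) * k (z⁻¹ * x) ∂μ ≤
      ENNReal.ofReal (ω z) * eLpNorm (F - ⇑f) 1 (ω.measure μ) := by
    rw [← lintegral_mul_left_eq_self _ z, ← hk, ← lintegral_const_mul' _ _ ENNReal.ofReal_ne_top]
    refine lintegral_mono fun x => ?_
    simp only [inv_mul_cancel_left]
    rw [← mul_assoc]
    rw [← ENNReal.ofReal_mul (ω.pos z).le]
    gcongr
    exact ω.mul_le _ _
  have hfz : ∀ᵐ x ∂μ, f (x * z⁻¹) = f (z⁻¹ * x) := by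
    have h1 := (measurePreserving_mul_left μ z⁻¹).quasiMeasurePreserving.ae (hf z⁻¹)
    filter_upwards [h1] with x hx
    rw [← hx]
    simp
  have hfm : AEMeasurable f μ := (f.memLp.1.mono_ac (ω.absolutelyContinuous' μ)).aemeasurable
  have hfm' : AEMeasurable (fun x => f (z⁻¹ * x)) μ :=
    hfm.comp_quasiMeasurePreserving (measurePreserving_mul_left μ z⁻¹).quasiMeasurePreserving
  rw [ω.lintegral_measure, two_mul]
  refine le_trans ?_ (add_le_add hr hl)
  rw [← lintegral_add_right']
  · refine lintegral_mono_ae ?_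
    filter_upwards [hfz] with x hx
    rw [← mul_add]
    gcongr
    have : F (x * z⁻¹) - F (z⁻¹ * x) =
        (F - ⇑f) (x * z⁻¹) - (F - ⇑f) (z⁻¹ * x) := by
      simp only [Pi.sub_apply, hx]
      ring
    rw [this]
    exact enorm_sub_le
  · refine ω.measurable_ofReal.aemeasurable.mul ?_
    have : AEMeasurable (fun x => F (z⁻¹ * x) - f (z⁻¹ * x)) μ :=
      (hF.comp (continuous_const_mul z⁻¹)).measurable.aemeasurable.sub hfm'
    exact this.enorm

theorem isInvInvariant_of_isMulRightInvariant [μ.IsMulRightInvariant] : μ.IsInvInvariant := by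
  constructor
  let c : ℝ≥0∞ := Measure.haarScalarFactor μ.inv μ
  have hc : μ.inv = c • μ := Measure.isMulLeftInvariant_eq_smul_of_regular μ.inv μ
  have h1 : Measure.map Inv.inv (Measure.map Inv.inv μ) = c ^ 2 • μ := by
    rw [← Measure.inv_def μ, hc, Measure.map_smul, ← Measure.inv_def μ, hc, smul_smul, pow_two]
  have μeq : μ = c ^ 2 • μ := by
    rw [Measure.map_map continuous_inv.measurable continuous_inv.measurable] at h1
    simpa only [inv_involutive, Function.Involutive.comp_self, Measure.map_id] using h1
  have K : TopologicalSpace.PositiveCompacts G := Classical.arbitrary _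
  have h2 : c ^ 2 * μ K = 1 ^ 2 * μ K := by
    conv_rhs => rw [μeq]
    simp
  have h3 : c ^ 2 = 1 ^ 2 :=
    (ENNReal.mul_left_inj (Measure.measure_pos_of_nonempty_interior _ K.interior_nonempty).ne'
          K.isCompact.measure_lt_top.ne).1 h2
  have h4 : c = 1 := (ENNReal.pow_right_strictMono two_ne_zero).injective h3
  rw [hc, h4, one_smul]

theorem eLpNorm_conv_sub_conv_le [μ.IsMulRightInvariant] {f : BeurlingAlgebra μ ω}
    (hf : IsCentral f) {F H : G → ℂ} (hF : Continuous F) (hF' : HasCompactSupport F)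
    (hH : Continuous H) (hH' : HasCompactSupport H) :
    eLpNorm (groupConv μ F H - groupConv μ H F) 1 (ω.measure μ) ≤
      2 * eLpNorm (F - ⇑f) 1 (ω.measure μ) * eLpNorm H 1 (ω.measure μ) := by
  have := isInvInvariant_of_isMulRightInvariant (μ := μ)
  have hFf : MemLp (F - ⇑f) 1 (ω.measure μ) := (memLp_one_iff_integrable.2
    (hF.integrable_of_hasCompactSupport hF')).sub f.memLp
  have hHi : Integrable H (ω.measure μ) := hH.integrable_of_hasCompactSupport hH'
  set e := (eLpNorm (F - ⇑f) 1 (ω.measure μ)).toReal with he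
  have hconv : ∀ x, groupConv μ F H x = ∫ z, F (x * z⁻¹) * H z ∂μ := by
    intro x
    unfold groupConv
    rw [← integral_mul_left_eq_self _ x, ← integral_inv_eq_self _ μ]
    simp
  have hcs : HasCompactSupport
      (Function.uncurry fun z x => ‖H z‖ * ‖F (x * z⁻¹) - F (z⁻¹ * x)‖) := by
    refine HasCompactSupport.intro
      (hH'.prod ((hF'.mul hH').union (hH'.mul hF'))) ?_
    rintro ⟨z, x⟩ h
    by_contra h'
    simp only [Function.uncurry] at h'
    have hz : z ∈ tsupport H := subset_tsupport _ (norm_ne_zero_iff.1 (left_ne_zero_of_mul h'))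
    have hx := norm_ne_zero_iff.1 (right_ne_zero_of_mul h')
    refine h ⟨hz, ?_⟩
    by_cases h1 : F (x * z⁻¹) = 0
    · have h2 : F (z⁻¹ * x) ≠ 0 := fun h2 => hx (by rw [h1, h2, sub_zero])
      exact Or.inr ⟨z, hz, _, subset_tsupport _ h2, by simp⟩
    · exact Or.inl ⟨_, subset_tsupport _ h1, z, hz, by simp⟩
  have hcont : Continuous
      (Function.uncurry fun z x => ‖H z‖ * ‖F (x * z⁻¹) - F (z⁻¹ * x)‖) := by
    simp only [Function.uncurry_def]
    fun_prop
  have hFr : ∀ z, Continuous fun x => F (x * z⁻¹) - F (z⁻¹ * x) := fun z => by fun_prop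
  have hinner : ∀ z, ∫ x, ‖F (x * z⁻¹) - F (z⁻¹ * x)‖ ∂(ω.measure μ) ≤ 2 * (ω z * e) := by
    intro z
    rw [integral_norm_eq_lintegral_enorm (hFr z).aestronglyMeasurable]
    have h1 := ENNReal.toReal_mono (ENNReal.mul_ne_top (by simp)
      (ENNReal.mul_ne_top ENNReal.ofReal_ne_top hFf.2.ne)) (lintegral_conj_sub_le hf hF z)
    simpa [ENNReal.toReal_ofReal (ω.pos z).le, he] using h1
  have hL : Continuous (groupConv μ F H - groupConv μ H F) :=
    (conv_continuous μ hF hF' hH).sub (conv_continuous μ hH hH' hF)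
  have hL' : HasCompactSupport (groupConv μ F H - groupConv μ H F) :=
    (conv_hasCompactSupport μ hF' hH').sub (conv_hasCompactSupport μ hH' hF')
  have hpt : ∀ x, ‖(groupConv μ F H - groupConv μ H F) x‖ ≤
      ∫ z, ‖H z‖ * ‖F (x * z⁻¹) - F (z⁻¹ * x)‖ ∂μ := by
    intro x
    have h1 : (groupConv μ F H - groupConv μ H F) x = ∫ z, H z * (F (x * z⁻¹) - F (z⁻¹ * x)) ∂μ := by
      rw [Pi.sub_apply, hconv, groupConv, ← integral_sub]
      · congr 1 with z
        ring
      · apply Continuous.integrable_of_hasCompactSupport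
        · fun_prop
        · exact hH'.mul_left
      · exact conv_integrable μ hH hH' hF x
    rw [h1]
    refine (norm_integral_le_integral_norm _).trans_eq ?_
    simp only [norm_mul]
  have hreal : ∫ x, ‖(groupConv μ F H - groupConv μ H F) x‖ ∂(ω.measure μ) ≤
      2 * e * ∫ x, ‖H x‖ ∂(ω.measure μ) := by
    calc _ ≤ ∫ x, ∫ z, ‖H z‖ * ‖F (x * z⁻¹) - F (z⁻¹ * x)‖ ∂μ ∂(ω.measure μ) := by
          refine integral_mono (hL.integrable_of_hasCompactSupport hL').norm ?_ hpt
          apply Continuous.integrable_of_hasCompactSupport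
          · rw [← continuousOn_univ]
            refine continuousOn_integral_of_compact_support (k := tsupport H) hH' ?_ ?_
            · exact (hcont.comp continuous_swap).continuousOn
            · intro x z _ hz
              simp [image_eq_zero_of_notMem_tsupport hz]
          · refine HasCompactSupport.intro (hcs.isCompact.image continuous_snd) fun x hx => ?_
            refine integral_eq_zero_of_ae (Eventually.of_forall fun z => ?_)
            by_contra h'
            exact hx ⟨(z, x), subset_tsupport _ h', rfl⟩
      _ = ∫ z, ∫ x, ‖H z‖ * ‖F (x * z⁻¹) - F (z⁻¹ * x)‖ ∂(ω.measure μ) ∂μ :=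
          (integral_integral_swap_of_hasCompactSupport hcont hcs).symm
      _ ≤ ∫ z, 2 * e * (ω z • ‖H z‖) ∂μ := by
          have hint : Integrable (fun z => ω z • ‖H z‖) μ := by
            have := hHi.norm
            rw [Weight.measure, integrable_withDensity_iff_integrable_smul' ω.measurable_ofReal
              (Eventually.of_forall fun _ => ENNReal.ofReal_lt_top)] at this
            simpa only [ENNReal.toReal_ofReal (ω.pos _).le] using this
          refine integral_mono_of_nonneg (Eventually.of_forall fun z => integral_nonneg fun x => by
            positivity) (hint.const_mul _) (Eventually.of_forall fun z => ?_)
          simp only [integral_const_mul, smul_eq_mul]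
          have := mul_le_mul_of_nonneg_left (hinner z) (norm_nonneg (H z))
          linarith
      _ = _ := by rw [integral_const_mul, ← ω.integral_measure]
  rw [eLpNorm_one_eq_lintegral_enorm, ← ofReal_integral_norm_eq_lintegral_enorm
    (hL.integrable_of_hasCompactSupport hL'), eLpNorm_one_eq_lintegral_enorm (f := H),
    ← ofReal_integral_norm_eq_lintegral_enorm hHi]
  refine (ENNReal.ofReal_le_ofReal hreal).trans_eq ?_
  rw [ENNReal.ofReal_mul (by positivity), ENNReal.ofReal_mul (by positivity), he,
    ENNReal.ofReal_toReal hFf.2.ne]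
  simp

end comm

theorem IsCentral.mul_comm {f h : BeurlingAlgebra μ ω} (hf : IsCentral f) :
    f * h = h * f := by
  rcases eq_or_ne f 0 with rfl | h0
  · rw [zero_mul, mul_zero]
  have hR : μ.IsMulRightInvariant := ⟨fun g => by
    have h1 := map_conj_eq_self hf h0 g
    have h2 : (conjEquiv g : G → G) = (· * g) ∘ (g⁻¹ * ·) := rfl
    rwa [h2, ← Measure.map_map (measurable_mul_const g) (measurable_const_mul g⁻¹),
      map_mul_left_eq_self] at h1⟩
  obtain ⟨F, hF, hFc, hFs, hFl⟩ := exists_seq f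
  obtain ⟨H, hH, hHc, hHs, hHl⟩ := exists_seq h
  have key : ∀ n, ‖mk (F n) (hF n) * mk (H n) (hH n) - mk (H n) (hH n) * mk (F n) (hF n)‖ ≤
      2 * ‖mk (F n) (hF n) - f‖ * ‖mk (H n) (hH n)‖ := by
    intro n
    have h1 := eLpNorm_conv_sub_conv_le hf (hFc n) (hFs n) (hHc n) (hHs n)
    have h2 : ‖mk (F n) (hF n) - f‖ = (eLpNorm (F n - ⇑f) 1 (ω.measure μ)).toReal := by
      rw [norm_eq]
      congr 1
      exact eLpNorm_congr_ae ((coeFn_sub _ _).trans ((coeFn_mk (hF n)).sub (EventuallyEq.refl _ f)))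
    have h3 : ‖mk (H n) (hH n)‖ = (eLpNorm (H n) 1 (ω.measure μ)).toReal := by
      rw [norm_eq, eLpNorm_congr_ae (coeFn_mk (hH n))]
    rw [h2, h3, norm_eq, mk_mul_mk, mk_mul_mk, eLpNorm_congr_ae
      ((coeFn_sub _ _).trans ((coeFn_mk _).sub (coeFn_mk _)))]
    have h4 := ENNReal.toReal_mono (ENNReal.mul_ne_top (ENNReal.mul_ne_top (by simp)
      ((hF n).sub f.memLp).2.ne) (hH n).2.ne) h1
    simpa using h4
  have hl : Tendsto (fun n => 2 * ‖mk (F n) (hF n) - f‖ * ‖mk (H n) (hH n)‖) atTop (𝓝 0) := by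
    have h1 := tendsto_iff_norm_sub_tendsto_zero.1 hFl
    have h2 := (h1.const_mul 2).mul hHl.norm
    simpa using h2
  have hz := squeeze_zero_norm key hl
  exact sub_eq_zero.1 (tendsto_nhds_unique ((tendsto_mul hFl hHl).sub (tendsto_mul hHl hFl)) hz)

end BeurlingAlgebra

namespace BeurlingAlgebra

variable {G : Type*} [Group G] [TopologicalSpace G] [IsTopologicalGroup G] [LocallyCompactSpace G]
  [T2Space G] [MeasurableSpace G] [BorelSpace G]

theorem exists_eLpNorm_conj_le (μ : Measure G) [μ.IsHaarMeasure] [μ.Regular] (ω : Weight G) (g : G) :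
    ∃ C : ℝ≥0∞, C ≠ ∞ ∧ ∀ k : G → ℂ, eLpNorm (fun x => k (g⁻¹ * x * g)) 1 (ω.measure μ) ≤
      C * eLpNorm k 1 (ω.measure μ) := by
  obtain ⟨c, hc⟩ := exists_map_conj μ g
  refine ⟨c * (ENNReal.ofReal (ω g) * ENNReal.ofReal (ω g⁻¹)), by finiteness, fun k => ?_⟩
  rw [eLpNorm_one_eq_lintegral_enorm, eLpNorm_one_eq_lintegral_enorm, ω.lintegral_measure,
    ω.lintegral_measure]
  let u : G → ℝ≥0∞ := fun w => ENNReal.ofReal (ω (g * w * g⁻¹)) * ‖k w‖ₑ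
  calc _ = ∫⁻ x, u (conjEquiv g x) ∂μ := by
        congr 1 with x
        simp only [u, conjEquiv_apply]
        congr 3
        group
    _ = ∫⁻ x, u x ∂(μ.map (conjEquiv g)) := (lintegral_map_equiv _ _).symm
    _ = c * ∫⁻ x, u x ∂μ := by
        rw [hc, lintegral_smul_measure]
        rfl
    _ ≤ c * ∫⁻ x, ENNReal.ofReal (ω g) * ENNReal.ofReal (ω g⁻¹) *
          (ENNReal.ofReal (ω x) * ‖k x‖ₑ) ∂μ := by
        gcongr with x
        simp only [u]
        rw [← mul_assoc, ← ENNReal.ofReal_mul (ω.pos _).le,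
          ← ENNReal.ofReal_mul (mul_pos (ω.pos _) (ω.pos _)).le]
        gcongr
        refine (ω.mul_le _ _).trans ?_
        have := mul_le_mul_of_nonneg_right (ω.mul_le g x) (ω.pos g⁻¹).le
        linarith
    _ = _ := by
        rw [lintegral_const_mul' _ _ (by finiteness), ← mul_assoc]

variable (μ : Measure G) [μ.IsHaarMeasure] [μ.Regular] (ω : Weight G)

theorem isClosed_isCentral : IsClosed {f : BeurlingAlgebra μ ω | IsCentral f} := by
  rw [← isSeqClosed_iff_isClosed]
  intro F f hF hlim g
  obtain ⟨C, hC, hle⟩ := exists_eLpNorm_conj_le μ ω g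
  have hconj : ∀ k : BeurlingAlgebra μ ω,
      AEStronglyMeasurable (fun x => k (g⁻¹ * x * g)) (ω.measure μ) := by
    intro k
    obtain ⟨c, hc⟩ := exists_map_conj μ g
    have hq : Measure.QuasiMeasurePreserving (conjEquiv g) μ μ :=
      ⟨(conjEquiv g).measurable, by rw [hc]; exact Measure.smul_absolutelyContinuous⟩
    exact ((k.memLp.1.mono_ac (ω.absolutelyContinuous' μ)).comp_quasiMeasurePreserving hq).mono_ac
      (ω.absolutelyContinuous μ)
  have hl : Tendsto (fun n => eLpNorm (⇑f - ⇑(F n)) 1 (ω.measure μ)) atTop (𝓝 0) := by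
    have h1 := tendsto_iff_norm_sub_tendsto_zero.1 hlim
    have h2 : ∀ n, eLpNorm (⇑f - ⇑(F n)) 1 (ω.measure μ) = ENNReal.ofReal ‖F n - f‖ := by
      intro n
      rw [norm_sub_rev, norm_eq, ENNReal.ofReal_toReal (f - F n).memLp.2.ne]
      exact eLpNorm_congr_ae (coeFn_sub f (F n)).symm
    have h3 : Tendsto (fun n => ENNReal.ofReal ‖F n - f‖) atTop (𝓝 (ENNReal.ofReal 0)) :=
      (ENNReal.continuous_ofReal.tendsto 0).comp h1
    rw [ENNReal.ofReal_zero] at h3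
    exact h3.congr fun n => (h2 n).symm
  have hbound : ∀ n, eLpNorm ((fun x => f (g⁻¹ * x * g)) - ⇑f) 1 (ω.measure μ) ≤
      C * eLpNorm (⇑f - ⇑(F n)) 1 (ω.measure μ) + eLpNorm (⇑f - ⇑(F n)) 1 (ω.measure μ) := by
    intro n
    have h1 : ((fun x => f (g⁻¹ * x * g)) - ⇑f) =ᵐ[ω.measure μ]
        (fun x => (⇑f - ⇑(F n)) (g⁻¹ * x * g)) - (⇑f - ⇑(F n)) := by
      filter_upwards [ae_measure (hF n g)] with x hx
      simp only [Pi.sub_apply, hx]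
      ring
    rw [eLpNorm_congr_ae h1]
    have h2 : AEStronglyMeasurable (fun x => (⇑f - ⇑(F n)) (g⁻¹ * x * g)) (ω.measure μ) :=
      (hconj f).sub (hconj (F n))
    have h3 := hle (⇑f - ⇑(F n))
    have h4 := eLpNorm_sub_le h2 (f.memLp.1.sub (F n).memLp.1) (le_refl 1)
    exact h4.trans (add_le_add h3 (le_refl _))
  have hz : eLpNorm ((fun x => f (g⁻¹ * x * g)) - ⇑f) 1 (ω.measure μ) = 0 := by
    have h1 := (ENNReal.Tendsto.const_mul hl (Or.inr hC)).add hl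
    simp only [mul_zero, add_zero] at h1
    exact nonpos_iff_eq_zero.1 (ge_of_tendsto' h1 hbound)
  rw [eLpNorm_eq_zero_iff ((hconj f).sub f.memLp.1) one_ne_zero] at hz
  filter_upwards [ae_haar hz] with x hx
  exact sub_eq_zero.1 hx

end BeurlingAlgebra

section center

variable {G : Type*} [Group G] [TopologicalSpace G] [IsTopologicalGroup G] [LocallyCompactSpace G]
  [T2Space G] [MeasurableSpace G] [BorelSpace G]
  (μ : Measure G) [μ.IsHaarMeasure] [μ.Regular] (ω : Weight G)

/-- The central Beurling algebra `ZL¹(G, ω)`: all `f` in `L¹(G, ω)` such that, for every `g`,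
`f (g⁻¹ x g) = f x` for almost every `x`. -/
noncomputable def centralBeurlingAlgebra : NonUnitalSubalgebra ℂ (BeurlingAlgebra μ ω) where
  carrier := {f | ∀ g : G, (fun x => f (g⁻¹ * x * g)) =ᵐ[μ] f}
  add_mem' hf hh := BeurlingAlgebra.IsCentral.add hf hh
  zero_mem' := BeurlingAlgebra.isCentral_zero
  smul_mem' c _ hf := BeurlingAlgebra.IsCentral.smul c hf
  mul_mem' hf hh := BeurlingAlgebra.IsCentral.mul hf hh

noncomputable instance : NonUnitalNormedCommRing (centralBeurlingAlgebra μ ω) where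
  __ := (inferInstance : NonUnitalNormedRing (centralBeurlingAlgebra μ ω))
  mul_comm f _ := Subtype.ext (BeurlingAlgebra.IsCentral.mul_comm f.2)

noncomputable instance : NormedSpace ℂ (centralBeurlingAlgebra μ ω) :=
  inferInstanceAs (NormedSpace ℂ (centralBeurlingAlgebra μ ω).toSubmodule)

instance : CompleteSpace (centralBeurlingAlgebra μ ω) :=
  (BeurlingAlgebra.isClosed_isCentral μ ω).completeSpace_coe

end center

/-- A commutative Banach algebra `A` is weakly amenable if every continuous derivation from `A`
into a commutative Banach `A`-module `X` is zero. Here `act a x` is the module product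
`a · x = x · a`. -/
def IsWeaklyAmenable.{u} (A : Type u) [NonUnitalNormedCommRing A] [NormedSpace ℂ A]
    [IsScalarTower ℂ A A] [SMulCommClass ℂ A A] [CompleteSpace A] : Prop :=
  ∀ (X : Type u) [NormedAddCommGroup X] [NormedSpace ℂ X] [CompleteSpace X]
    (act : A →L[ℂ] X →L[ℂ] X), (∀ a b x, act (a * b) x = act a (act b x)) →
    ∀ D : A →L[ℂ] X, (∀ a b, D (a * b) = act a (D b) + act b (D a)) → D = 0

/-- A topological group is an `[FC]⁻` group if all its conjugacy classes have compact closure. -/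
def IsFCGroup (G : Type*) [Group G] [TopologicalSpace G] : Prop :=
  ∀ x : G, IsCompact (closure (Set.range fun g : G => g * x * g⁻¹))

/-!
The derivation takes values in the dual of `ZL¹(G, ω)`. Multiplication by the additive character
`Φ` is a derivation for convolution, but `Φ f` need not lie in `L¹(G, ω)`. The form
`T(f, h) = ∫_V (Φ f) * h`, where `V` is an open relatively compact set invariant under inner
automorphisms, is nevertheless bounded: for `y⁻¹ x` with `x ∈ V` the weight is at least a multiple
of `ω(y⁻¹)`, and `|Φ(y)| ≤ B ω(y) ω(y⁻¹)` absorbs the rest (`exists_norm_preForm_le`). So `T`, which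
is defined for compactly supported continuous `f`, extends to all of `L¹(G, ω)` (`form`).

As `V` is invariant and `G` is unimodular, `l = ∫_V` is a trace on `L¹(G, ω)`
(`integralCLM_mul_comm`). With the Leibniz rule for `Φ` and the fact that central elements commute
with everything, this gives `T(a b, h) = T(a, b h) + T(b, a h)` for central `h` (`form_mul`), which
says that `a ↦ T(a, ·)` is a derivation on `ZL¹(G, ω)`.

It is not zero: let `W` be an invariant relatively compact open set that contains a point `t` with
`Φ t ≠ 0`, and let `V` contain all products of elements of a compact neighbourhood of the closure of
`W`. Then convolutions of functions supported in `W` live in `V`, and hence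
`T(1_W conj Φ, 1_W) = (∫_W |Φ|²) μ(W) > 0` (`form_eq_of_support`). Arbitrarily large invariant
sets exist because `[FC]⁻` groups are `[IN]` groups, by an argument of Baire type
(`IsFCGroup.exists_isOpen_conj_subset`).

Convolution identities are proved for compactly supported continuous functions, where Fubini's
theorem needs neither σ-finiteness nor product measurability, and then extended by density.
-/

open scoped CompactlySupported

/-! ### Invariant open sets in groups with relatively compact conjugacy classes -/

section invariant

variable {G : Type*} [Group G] [TopologicalSpace G] [IsTopologicalGroup G]

/-- One step of the construction in `IsFCGroup.exists_isOpen_conj_subset`: if no compact set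
contains all the conjugates of `O`, then `O` can be shrunk around a point some conjugate of which
avoids a given compact set. -/
theorem exists_isOpen_closure_subset_conj_notMem [LocallyCompactSpace G] [T2Space G] {O C : Set G}
    (hO : IsOpen O) (hC : IsCompact C) (h : ¬ ∀ g : G, ∀ x ∈ O, g * x * g⁻¹ ∈ C) :
    ∃ (O' : Set G) (g : G), IsOpen O' ∧ O'.Nonempty ∧ closure O' ⊆ O ∧ IsCompact (closure O') ∧
      ∀ x ∈ closure O', g * x * g⁻¹ ∉ C := by
  push Not at h
  obtain ⟨g, x, hx, hgx⟩ := h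
  have hU : IsOpen (O ∩ (fun x => g * x * g⁻¹) ⁻¹' Cᶜ) :=
    hO.inter (hC.isClosed.isOpen_compl.preimage (by fun_prop))
  obtain ⟨O', hO', hxO', hsub, hcomp⟩ :=
    exists_open_between_and_isCompact_closure isCompact_singleton hU
      (Set.singleton_subset_iff.2 ⟨hx, hgx⟩)
  exact ⟨O', g, hO', ⟨x, hxO' rfl⟩, fun y hy => (hsub hy).1, hcomp, fun y hy => (hsub hy).2⟩

/-- In an `[FC]⁻` group, the conjugates of some nonempty open set all lie in one compact set.
Otherwise, given a compact neighbourhood `U` of `1`, a nested sequence of relatively compact open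
sets `O n` and elements `g n` are chosen such that `g n x (g n)⁻¹ ∉ U (g i x (g i)⁻¹)` for all
`i < n` and `x ∈ O (n + 1)`. A common point `x` of the closures then has a sequence of conjugates
which are too far apart for a compact set. -/
theorem IsFCGroup.exists_isOpen_conj_subset [LocallyCompactSpace G] [T2Space G]
    (hG : IsFCGroup G) :
    ∃ O C : Set G, IsOpen O ∧ O.Nonempty ∧ IsCompact C ∧ ∀ g : G, ∀ x ∈ O, g * x * g⁻¹ ∈ C := by
  by_contra! hcon
  obtain ⟨U, hU, hU1⟩ := exists_compact_mem_nhds (1 : G)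
  -- A state of the construction: the current open set, and a compact set which contains
  -- `U (g i x (g i)⁻¹)` for all earlier `g i` and all `x` in the open set.
  let S := {p : Set G × Set G // IsOpen p.1 ∧ p.1.Nonempty ∧ IsCompact p.2}
  have step : ∀ p : S, ∃ (q : S) (g : G), closure q.1.1 ⊆ p.1.1 ∧ IsCompact (closure q.1.1) ∧
      p.1.2 ⊆ q.1.2 ∧ (∀ x ∈ closure q.1.1, g * x * g⁻¹ ∉ p.1.2) ∧
      ∀ x ∈ closure q.1.1, ∀ u ∈ U, u * (g * x * g⁻¹) ∈ q.1.2 := by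
    rintro ⟨⟨O, C⟩, hO, hne, hC⟩
    obtain ⟨O', g, hO', hne', hsub, hcomp, hav⟩ := exists_isOpen_closure_subset_conj_notMem hO hC
      fun h => by
        obtain ⟨g, x, hx, hgx⟩ := hcon O C hO hne hC
        exact hgx (h g x hx)
    refine ⟨⟨⟨O', C ∪ U * ((fun x => g * x * g⁻¹) '' closure O')⟩, hO', hne',
      hC.union (hU.mul (hcomp.image (by fun_prop)))⟩, g, hsub, hcomp, Set.subset_union_left, hav,
      fun x hx u hu => Or.inr ⟨u, hu, _, ⟨x, hx, rfl⟩, rfl⟩⟩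
  choose next g hsub hcomp hCsub hav hmem using step
  let s : ℕ → S := fun n => next^[n] ⟨⟨Set.univ, ∅⟩, isOpen_univ, ⟨1, trivial⟩, isCompact_empty⟩
  have hs : ∀ n, s (n + 1) = next (s n) := fun n => Function.iterate_succ_apply' _ _ _
  have hanti : ∀ n, closure (s (n + 1 + 1)).1.1 ⊆ closure (s (n + 1)).1.1 := fun n => by
    rw [hs (n + 1)]
    exact (hsub _).trans subset_closure
  obtain ⟨x, hx⟩ := IsCompact.nonempty_iInter_of_sequence_nonempty_isCompact_isClosed
    (fun n => closure (s (n + 1)).1.1) hanti (fun n => (s (n + 1)).2.2.1.closure)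
    (by simp only [hs]; exact hcomp _) fun n => isClosed_closure
  rw [Set.mem_iInter] at hx
  have hx' : ∀ n, x ∈ closure (next (s n)).1.1 := fun n => hs n ▸ hx n
  let y : ℕ → G := fun n => g (s n) * x * (g (s n))⁻¹
  have hCmono : Monotone fun n => (s n).1.2 := monotone_nat_of_le_succ fun n => by
    rw [hs n]
    exact hCsub _
  have hsep : ∀ i n, i < n → ∀ u ∈ U, y n ≠ u * y i := by
    intro i n hin u hu heq
    refine hav (s n) x (hx' n) (hCmono (Nat.succ_le_of_lt hin) ?_)
    change y n ∈ (s (i + 1)).1.2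
    rw [heq, hs i]
    exact hmem (s i) x (hx' i) u hu
  have hycomp : ∀ n, y n ∈ closure (Set.range fun g : G => g * x * g⁻¹) := fun n =>
    subset_closure ⟨g (s n), rfl⟩
  -- A cluster point `z` has a neighbourhood `N` with `N N⁻¹ ⊆ U` that contains two of the `y n`.
  obtain ⟨z, -, hz⟩ := (hG x).exists_mapClusterPt_of_frequently
    (l := atTop) (f := y) (Frequently.of_forall hycomp)
  have hN : {p : G × G | p.1 * p.2⁻¹ ∈ U} ∈ 𝓝 (z, z) := by
    have h1 : Tendsto (fun p : G × G => p.1 * p.2⁻¹) (𝓝 (z, z)) (𝓝 (z * z⁻¹)) :=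
      (by fun_prop : Continuous fun p : G × G => p.1 * p.2⁻¹).tendsto (z, z)
    rw [mul_inv_cancel] at h1
    exact h1 hU1
  rw [nhds_prod_eq] at hN
  obtain ⟨N, hNz, hNU⟩ := mem_prod_same_iff.1 hN
  have hfreq := mapClusterPt_iff_frequently.1 hz N hNz
  obtain ⟨i, hi⟩ := hfreq.exists
  obtain ⟨n, hn, hyn⟩ := (frequently_atTop.1 hfreq) (i + 1)
  refine hsep i n hn (y n * (y i)⁻¹) (hNU (Set.mk_mem_prod hyn hi)) (by simp)

/-- A set which is open, relatively compact and invariant under all inner automorphisms. -/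
structure IsInvariantOpen (V : Set G) : Prop where
  isOpen : IsOpen V
  isCompact_closure : IsCompact (closure V)
  conj_mem : ∀ g : G, ∀ x ∈ V, g * x * g⁻¹ ∈ V

theorem IsInvariantOpen.conj_mem_iff {V : Set G} (hV : IsInvariantOpen V) (g x : G) :
    g⁻¹ * x * g ∈ V ↔ x ∈ V := by
  constructor
  · intro h
    simpa [mul_assoc] using hV.conj_mem g _ h
  · intro h
    simpa using hV.conj_mem g⁻¹ _ h

/-- `[FC]⁻` groups are `[IN]` groups, with arbitrarily large invariant sets: every compact set lies
in an invariant relatively compact open set. -/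
theorem IsFCGroup.exists_isInvariantOpen [LocallyCompactSpace G] [T2Space G] (hG : IsFCGroup G)
    {K : Set G} (hK : IsCompact K) : ∃ V : Set G, K ⊆ V ∧ IsInvariantOpen V := by
  obtain ⟨O, C, hO, ⟨w, hw⟩, hC, hOC⟩ := hG.exists_isOpen_conj_subset
  let W : Set G := ⋃ g : G, (fun x => g * x * g⁻¹) ⁻¹' O
  have hW : IsOpen W := isOpen_iUnion fun g => hO.preimage (by fun_prop)
  have hWC : W ⊆ C := by
    intro x hx
    obtain ⟨g, hg⟩ := Set.mem_iUnion.1 hx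
    have := hOC g⁻¹ _ hg
    simpa [mul_assoc] using this
  have hWconj : ∀ g : G, ∀ x ∈ W, g * x * g⁻¹ ∈ W := by
    intro g x hx
    obtain ⟨h, hh⟩ := Set.mem_iUnion.1 hx
    refine Set.mem_iUnion.2 ⟨h * g⁻¹, ?_⟩
    have : h * g⁻¹ * (g * x * g⁻¹) * (h * g⁻¹)⁻¹ = h * x * h⁻¹ := by group
    rwa [Set.mem_preimage, this]
  have hwW : w ∈ W := Set.mem_iUnion.2 ⟨1, by simpa using hw⟩
  obtain ⟨t, ht⟩ := hK.elim_finite_subcover (fun x : G => (x * ·) '' W)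
    (fun x => (Homeomorph.mulLeft x).isOpenMap _ hW)
    (fun x _ => Set.mem_iUnion.2 ⟨x * w⁻¹, w, hwW, by simp⟩)
  refine ⟨⋃ x ∈ t, (Set.range fun g : G => g * x * g⁻¹) * W, ?_, ?_, ?_, ?_⟩
  · intro y hy
    obtain ⟨x, hx, v, hv, rfl⟩ := Set.mem_iUnion₂.1 (ht hy)
    exact Set.mem_iUnion₂.2 ⟨x, hx, x, ⟨1, by simp⟩, v, hv, rfl⟩
  · exact isOpen_biUnion fun x _ => hW.mul_left
  · have hc : IsCompact (⋃ x ∈ t, closure (Set.range fun g : G => g * x * g⁻¹) * C) :=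
      t.isCompact_biUnion fun x _ => (hG x).mul hC
    refine hc.closure_of_subset (Set.iUnion₂_mono fun x _ => Set.mul_subset_mul subset_closure hWC)
  · intro g y hy
    obtain ⟨x, hx, _, ⟨h, rfl⟩, v, hv, rfl⟩ := Set.mem_iUnion₂.1 hy
    refine Set.mem_iUnion₂.2 ⟨x, hx, _, ⟨g * h, rfl⟩, g * v * g⁻¹, hWconj g v hv, ?_⟩
    simp only
    group

end invariant

/-! ### Functionals on the Beurling algebra and compactly supported functions -/

section weightBounds

variable {G : Type*} [Group G] [TopologicalSpace G] [IsTopologicalGroup G] [LocallyCompactSpace G]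
  [T2Space G] [MeasurableSpace G] [BorelSpace G]

/-- A weight is bounded away from zero on compact sets. -/
theorem Weight.exists_one_le_mul_of_isCompact (ω : Weight G) (μ : Measure G) [μ.IsHaarMeasure]
    [μ.Regular] {K : Set G} (hK : IsCompact K) : ∃ C : ℝ, 0 < C ∧ ∀ x ∈ K, 1 ≤ C * ω x := by
  obtain ⟨C, hC0, hC⟩ := ω.bound_of_isCompact μ hK.inv
  refine ⟨C, hC0, fun x hx => ?_⟩
  rw [mul_comm]
  exact (ω.inv_bound x).trans (mul_le_mul_of_nonneg_left (hC _ (Set.inv_mem_inv.2 hx)) (ω.pos x).le)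

theorem Weight.integrable_measure_iff {G : Type*} [Group G] [MeasurableSpace G] (ω : Weight G)
    (μ : Measure G) {f : G → ℂ} :
    Integrable f (ω.measure μ) ↔ Integrable (fun x => ω x • f x) μ := by
  rw [Weight.measure, integrable_withDensity_iff_integrable_smul' ω.measurable_ofReal
    (Eventually.of_forall fun _ => ENNReal.ofReal_lt_top)]
  simp only [ENNReal.toReal_ofReal (ω.pos _).le]

/-- Continuous functions cut off outside a relatively compact open set are in `L¹(G, ω)`. -/
theorem Weight.memLp_indicator (ω : Weight G) (μ : Measure G) [μ.IsHaarMeasure] [μ.Regular]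
    {W : Set G} (hW : IsOpen W) (hWc : IsCompact (closure W)) {k : G → ℂ} (hk : Continuous k) :
    MemLp (W.indicator k) 1 (ω.measure μ) := by
  rw [memLp_one_iff_integrable, integrable_indicator_iff hW.measurableSet]
  exact (hk.continuousOn.integrableOn_compact hWc).mono_set subset_closure

end weightBounds

namespace BeurlingAlgebra

section functional

variable {G : Type*} [Group G] [MeasurableSpace G] {μ : Measure G} {ω : Weight G}

theorem integrable_norm_mul (f : BeurlingAlgebra μ ω) : Integrable (fun x => ‖f x‖ * ω x) μ := by
  have h := ((ω.integrable_measure_iff μ).1 (memLp_one_iff_integrable.1 f.memLp)).norm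
  refine h.congr (Eventually.of_forall fun x => ?_)
  simp only [norm_smul, Real.norm_eq_abs, abs_of_pos (ω.pos x), mul_comm]

theorem norm_mk {f : G → ℂ} (hf : MemLp f 1 (ω.measure μ)) :
    ‖mk f hf‖ = ∫ x, ‖f x‖ * ω x ∂μ := by
  rw [norm_eq_integral]
  refine integral_congr_ae ?_
  filter_upwards [ae_haar (coeFn_mk hf)] with x hx
  rw [hx]

/-- `m` is a measurable function with `|m| ≤ C ω`. Such functions represent continuous linear
functionals on `L¹(G, ω)`. -/
structure IsWeightBounded (ω : Weight G) (m : G → ℂ) (C : ℝ) : Prop where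
  meas : Measurable m
  le : ∀ x, ‖m x‖ ≤ C * ω x

theorem IsWeightBounded.norm_mul_le {m : G → ℂ} {C : ℝ} (hm : IsWeightBounded ω m C)
    (f : BeurlingAlgebra μ ω) (x : G) : ‖m x * f x‖ ≤ C * (‖f x‖ * ω x) := by
  rw [norm_mul]
  calc _ ≤ C * ω x * ‖f x‖ := mul_le_mul_of_nonneg_right (hm.le x) (norm_nonneg _)
    _ = _ := by ring

theorem IsWeightBounded.integrable {m : G → ℂ} {C : ℝ} (hm : IsWeightBounded ω m C)
    (f : BeurlingAlgebra μ ω) : Integrable (fun x => m x * f x) μ :=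
  (f.integrable_norm_mul.const_mul C).mono'
    (hm.meas.aestronglyMeasurable.mul (f.memLp.1.mono_ac (ω.absolutelyContinuous' μ)))
    (Eventually.of_forall (hm.norm_mul_le f))

/-- The continuous linear functional `f ↦ ∫ m(x) f(x) dx` on `L¹(G, ω)`. -/
noncomputable def integralCLM {m : G → ℂ} {C : ℝ} (hm : IsWeightBounded ω m C) :
    BeurlingAlgebra μ ω →L[ℂ] ℂ :=
  LinearMap.mkContinuous
    { toFun := fun f => ∫ x, m x * f x ∂μ
      map_add' := fun f h => by
        rw [← integral_add (hm.integrable f) (hm.integrable h)]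
        refine integral_congr_ae ?_
        filter_upwards [ae_haar (coeFn_add f h)] with x hx
        rw [hx, Pi.add_apply, mul_add]
      map_smul' := fun c f => by
        rw [RingHom.id_apply, smul_eq_mul, ← integral_const_mul]
        refine integral_congr_ae ?_
        filter_upwards [ae_haar (coeFn_smul c f)] with x hx
        rw [hx, Pi.smul_apply, smul_eq_mul, mul_left_comm] }
    C fun f => by
      rw [norm_eq_integral, ← integral_const_mul]
      exact norm_integral_le_of_norm_le (f.integrable_norm_mul.const_mul C)
        (Eventually.of_forall (hm.norm_mul_le f))

theorem integralCLM_apply {m : G → ℂ} {C : ℝ} (hm : IsWeightBounded ω m C)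
    (f : BeurlingAlgebra μ ω) : integralCLM hm f = ∫ x, m x * f x ∂μ := rfl

theorem integralCLM_mk {m : G → ℂ} {C : ℝ} (hm : IsWeightBounded ω m C) {f : G → ℂ}
    (hf : MemLp f 1 (ω.measure μ)) : integralCLM hm (mk f hf) = ∫ x, m x * f x ∂μ := by
  rw [integralCLM_apply]
  refine integral_congr_ae ?_
  filter_upwards [ae_haar (coeFn_mk hf)] with x hx
  rw [hx]

end functional

variable {G : Type*} [Group G] [TopologicalSpace G] [IsTopologicalGroup G] [LocallyCompactSpace G]
  [T2Space G] [MeasurableSpace G] [BorelSpace G]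
  {μ : Measure G} [μ.IsHaarMeasure] [μ.Regular] {ω : Weight G}

theorem exists_isWeightBounded_indicator (μ : Measure G) [μ.IsHaarMeasure] [μ.Regular]
    (ω : Weight G) {K L : Set G} (hK : IsCompact K) (hLK : L ⊆ K) (hL : MeasurableSet L) {m : G → ℂ}
    (hm : Continuous m) : ∃ C : ℝ, IsWeightBounded ω (L.indicator m) C := by
  obtain ⟨C, hC0, hC⟩ := ω.exists_one_le_mul_of_isCompact μ hK
  obtain ⟨B, hB⟩ := hK.exists_bound_of_continuousOn hm.continuousOn
  refine ⟨max B 0 * C, hm.measurable.indicator hL, fun x => ?_⟩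
  have hω := (ω.pos x).le
  by_cases hx : x ∈ L
  · rw [Set.indicator_of_mem hx, mul_assoc]
    calc ‖m x‖ ≤ max B 0 * 1 := by rw [mul_one]; exact (hB x (hLK hx)).trans (le_max_left _ _)
      _ ≤ _ := mul_le_mul_of_nonneg_left (hC x (hLK hx)) (le_max_right _ _)
  · rw [Set.indicator_of_notMem hx, norm_zero]
    have := le_max_right B 0
    positivity

theorem memLp_of_compactlySupported (μ : Measure G) [μ.IsHaarMeasure] [μ.Regular] (ω : Weight G)
    (F : C_c(G, ℂ)) : MemLp F 1 (ω.measure μ) :=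
  memLp_one_iff_integrable.2 (F.continuous.integrable_of_hasCompactSupport F.hasCompactSupport)

variable (μ ω) in
/-- The inclusion of the compactly supported continuous functions into `L¹(G, ω)`. -/
noncomputable def ofCompactlySupported : C_c(G, ℂ) →ₗ[ℂ] BeurlingAlgebra μ ω where
  toFun F := mk F (memLp_of_compactlySupported μ ω F)
  map_add' F H := ext_ae <| by
    filter_upwards [coeFn_mk (memLp_of_compactlySupported μ ω (F + H)),
      coeFn_mk (memLp_of_compactlySupported μ ω F), coeFn_mk (memLp_of_compactlySupported μ ω H),
      coeFn_add (mk F (memLp_of_compactlySupported μ ω F))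
        (mk H (memLp_of_compactlySupported μ ω H))] with x h1 h2 h3 h4
    rw [h1, h4, Pi.add_apply, h2, h3]
    rfl
  map_smul' c F := ext_ae <| by
    filter_upwards [coeFn_mk (memLp_of_compactlySupported μ ω (c • F)),
      coeFn_mk (memLp_of_compactlySupported μ ω F),
      coeFn_smul c (mk F (memLp_of_compactlySupported μ ω F))] with x h1 h2 h3
    rw [h1, RingHom.id_apply, h3, Pi.smul_apply, h2]
    rfl

theorem ofCompactlySupported_apply (F : C_c(G, ℂ)) :
    ofCompactlySupported μ ω F = mk F (memLp_of_compactlySupported μ ω F) := rfl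

theorem denseRange_ofCompactlySupported : DenseRange (ofCompactlySupported μ ω) := by
  intro f
  obtain ⟨F, hF, hFc, hFs, hFl⟩ := exists_seq f
  exact mem_closure_of_tendsto hFl (Eventually.of_forall fun n =>
    ⟨⟨⟨F n, hFc n⟩, hFs n⟩, rfl⟩)

variable (μ) in
/-- The convolution of compactly supported continuous functions. -/
noncomputable def convCompactlySupported (F H : C_c(G, ℂ)) : C_c(G, ℂ) :=
  ⟨⟨groupConv μ F H, conv_continuous μ F.continuous F.hasCompactSupport H.continuous⟩,
    conv_hasCompactSupport μ F.hasCompactSupport H.hasCompactSupport⟩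

theorem convCompactlySupported_apply (F H : C_c(G, ℂ)) (x : G) :
    convCompactlySupported μ F H x = groupConv μ F H x := rfl

theorem ofCompactlySupported_conv (F H : C_c(G, ℂ)) :
    ofCompactlySupported μ ω (convCompactlySupported μ F H) =
      ofCompactlySupported μ ω F * ofCompactlySupported μ ω H :=
  (mk_mul_mk (memLp_of_compactlySupported μ ω F) (memLp_of_compactlySupported μ ω H)).symm

/-- An element of `L¹(G, ω)` which vanishes off a compact set `K` is a limit of continuous functions
with support in any given compact neighbourhood of `K`. -/
theorem exists_seq_support_subset {f : BeurlingAlgebra μ ω} {K L : Set G} (hK : IsCompact K)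
    (hKL : K ⊆ interior L) (hf : ∀ᵐ x ∂μ, x ∉ K → f x = 0) :
    ∃ F : ℕ → C_c(G, ℂ), (∀ n x, x ∉ L → F n x = 0) ∧
      Tendsto (fun n => ofCompactlySupported μ ω (F n)) atTop (𝓝 f) := by
  obtain ⟨F, hF, hFc, hFs, hFl⟩ := exists_seq f
  obtain ⟨χ, hχ1, hχ0, -, hχ⟩ := exists_continuous_one_zero_of_isCompact hK
    isOpen_interior.isClosed_compl (Set.disjoint_compl_right_iff_subset.2 hKL)
  let P : ℕ → C_c(G, ℂ) := fun n =>
    ⟨⟨fun x => (χ x : ℂ) * F n x, by have := hFc n; fun_prop⟩, (hFs n).mul_left⟩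
  refine ⟨P, fun n x hx => ?_, ?_⟩
  · have : χ x = 0 := hχ0 fun h => hx (interior_subset h)
    change (χ x : ℂ) * F n x = 0
    rw [this, Complex.ofReal_zero, zero_mul]
  · rw [tendsto_iff_norm_sub_tendsto_zero] at hFl ⊢
    refine squeeze_zero (fun _ => norm_nonneg _) (fun n => ?_) hFl
    rw [norm_eq, norm_eq]
    refine ENNReal.toReal_mono (mk (F n) (hF n) - f).memLp.2.ne (eLpNorm_mono_ae ?_)
    filter_upwards [ω.absolutelyContinuous μ hf, coeFn_sub (ofCompactlySupported μ ω (P n)) f,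
      coeFn_mk (memLp_of_compactlySupported μ ω (P n)), coeFn_sub (mk (F n) (hF n)) f,
      coeFn_mk (hF n)] with x h1 h2 h3 h4 h5
    rw [h2, h4, Pi.sub_apply, Pi.sub_apply, ofCompactlySupported_apply, h3, h5]
    have h6 : (χ x : ℂ) * f x = f x := by
      by_cases hx : x ∈ K
      · have : χ x = 1 := hχ1 hx
        rw [this, Complex.ofReal_one, one_mul]
      · rw [h1 hx, mul_zero]
    change ‖(χ x : ℂ) * F n x - f x‖ ≤ _
    calc ‖(χ x : ℂ) * F n x - f x‖ = ‖χ x‖ * ‖F n x - f x‖ := by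
          rw [← Complex.norm_real (χ x), ← norm_mul, mul_sub, h6]
      _ ≤ 1 * ‖F n x - f x‖ := by
          gcongr
          rw [Real.norm_eq_abs, abs_of_nonneg (hχ x).1]
          exact (hχ x).2
      _ = _ := one_mul _

end BeurlingAlgebra

/-! ### Integration over an invariant set -/

section trace

variable {G : Type*} [Group G] [TopologicalSpace G] [IsTopologicalGroup G] [LocallyCompactSpace G]
  [T2Space G] [MeasurableSpace G] [BorelSpace G]
  (μ : Measure G) [μ.IsHaarMeasure] [μ.Regular]

/-- The Haar measure of a nonempty invariant relatively compact open set is positive and finite, so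
inner automorphisms preserve the Haar measure. -/
theorem IsInvariantOpen.map_conj_eq_self {V : Set G} (hV : IsInvariantOpen V) (hne : V.Nonempty)
    (g : G) : μ.map (conjEquiv g) = μ := by
  obtain ⟨c, hc⟩ := exists_map_conj μ g
  have h1 : μ.map (conjEquiv g) V = μ V := by
    rw [MeasurableEquiv.map_apply]
    congr 1
    ext x
    exact hV.conj_mem_iff g x
  rw [hc, Measure.smul_apply] at h1
  have h2 : (c : ℝ≥0∞) * μ V = 1 * μ V := by rw [one_mul]; exact h1
  have h3 : (c : ℝ≥0∞) = 1 :=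
    (ENNReal.mul_left_inj (hV.isOpen.measure_pos μ hne).ne'
      ((measure_mono subset_closure).trans_lt hV.isCompact_closure.measure_lt_top).ne).1 h2
  rw [hc, ENNReal.coe_eq_one.1 h3, one_smul]

theorem isMulRightInvariant_of_map_conj (h : ∀ g : G, μ.map (conjEquiv g) = μ) :
    μ.IsMulRightInvariant := ⟨fun g => by
  have h1 := h g
  have h2 : (conjEquiv g : G → G) = (· * g) ∘ (g⁻¹ * ·) := rfl
  rwa [h2, ← Measure.map_map (measurable_mul_const g) (measurable_const_mul g⁻¹),
    map_mul_left_eq_self] at h1⟩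

theorem setIntegral_groupConv (V : Set G) (F H : C_c(G, ℂ)) :
    ∫ x in V, groupConv μ F H x ∂μ = ∫ y, F y * ∫ x in V, H (y⁻¹ * x) ∂μ ∂μ := by
  unfold groupConv
  have hF := F.continuous
  have hH := H.continuous
  rw [← integral_integral_swap_of_hasCompactSupport (f := fun y x => F y * H (y⁻¹ * x))
    (by simp only [Function.uncurry_def]; fun_prop)
    (conv_hasCompactSupport_uncurry F.hasCompactSupport H.hasCompactSupport)]
  simp_rw [integral_const_mul]

/-- Integration over an invariant set is a trace. -/
theorem setIntegral_groupConv_comm {V : Set G} (hV : IsInvariantOpen V)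
    (hμ : ∀ g : G, μ.map (conjEquiv g) = μ) (F H : C_c(G, ℂ)) :
    ∫ x in V, groupConv μ F H x ∂μ = ∫ x in V, groupConv μ H F x ∂μ := by
  have := isMulRightInvariant_of_map_conj μ hμ
  have := BeurlingAlgebra.isInvInvariant_of_isMulRightInvariant (μ := μ)
  have hF := F.continuous
  have hH := H.continuous
  have hconv : ∀ x, groupConv μ H F x = ∫ y, F y * H (x * y⁻¹) ∂μ := by
    intro x
    unfold groupConv
    rw [← integral_mul_left_eq_self _ x, ← integral_inv_eq_self _ μ]
    simp [mul_comm]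
  have hcs : HasCompactSupport (Function.uncurry fun y x => F y * H (x * y⁻¹)) := by
    refine HasCompactSupport.intro
      (F.hasCompactSupport.prod (H.hasCompactSupport.mul F.hasCompactSupport)) ?_
    rintro ⟨y, x⟩ h
    by_contra h'
    have hy : y ∈ tsupport F := subset_tsupport _ (left_ne_zero_of_mul h')
    exact h ⟨hy, _, subset_tsupport _ (right_ne_zero_of_mul h'), y, hy, by simp⟩
  rw [setIntegral_groupConv]
  simp_rw [hconv]
  rw [← integral_integral_swap_of_hasCompactSupport (f := fun y x => F y * H (x * y⁻¹))
    (by simp only [Function.uncurry_def]; fun_prop) hcs]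
  simp_rw [integral_const_mul]
  congr 1 with y
  congr 1
  rw [← integral_indicator hV.isOpen.measurableSet, ← integral_indicator hV.isOpen.measurableSet]
  have h1 := integral_map_equiv (μ := μ) (conjEquiv y) (V.indicator fun x => H (x * y⁻¹))
  rw [hμ] at h1
  rw [h1]
  congr 1 with x
  rw [conjEquiv_apply]
  by_cases hx : x ∈ V
  · rw [Set.indicator_of_mem hx, Set.indicator_of_mem ((hV.conj_mem_iff y x).2 hx),
      mul_inv_cancel_right]
  · rw [Set.indicator_of_notMem hx, Set.indicator_of_notMem fun h => hx ((hV.conj_mem_iff y x).1 h)]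

/-- The integral over `V` of a convolution of functions supported in `K` is the product of the
integrals if `V` contains the products of elements of `K`. -/
theorem setIntegral_groupConv_of_support {V K : Set G} (hKV : K * K ⊆ V) {F H : C_c(G, ℂ)}
    (hF : ∀ x, x ∉ K → F x = 0) (hH : ∀ x, x ∉ K → H x = 0) :
    ∫ x in V, groupConv μ F H x ∂μ = (∫ x, F x ∂μ) * ∫ x, H x ∂μ := by
  rw [setIntegral_groupConv, ← integral_mul_const]
  congr 1 with y
  by_cases hy : y ∈ K
  · congr 1
    rw [setIntegral_eq_integral_of_forall_compl_eq_zero, integral_mul_left_eq_self]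
    intro x hx
    refine hH _ fun h => hx (hKV ⟨y, hy, _, h, ?_⟩)
    simp
  · rw [hF y hy, zero_mul, zero_mul]

/-- If `ω(x⁻¹) ≤ S` on `V`, then `ω(y⁻¹) ∫_{y⁻¹ V} |H| ≤ S ∫ |H| ω`. -/
theorem Weight.mul_norm_setIntegral_le (ω : Weight G) {V : Set G} (hV : MeasurableSet V) {S : ℝ}
    (hS0 : 0 ≤ S) (hS : ∀ x ∈ V, ω x⁻¹ ≤ S) (H : C_c(G, ℂ)) (y : G) :
    ω y⁻¹ * ‖∫ x in V, H (y⁻¹ * x) ∂μ‖ ≤ S * ∫ x, ‖H x‖ * ω x ∂μ := by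
  have hint : Integrable (fun x => S * (‖H x‖ * ω x)) μ := by
    have h := ((ω.integrable_measure_iff μ).1 (memLp_one_iff_integrable.1
      (BeurlingAlgebra.memLp_of_compactlySupported μ ω H))).norm.const_mul S
    refine h.congr (Eventually.of_forall fun x => ?_)
    simp only [norm_smul, Real.norm_eq_abs, abs_of_pos (ω.pos x), mul_comm (ω x)]
  have hint' := hint.comp_mul_left y⁻¹
  calc ω y⁻¹ * ‖∫ x in V, H (y⁻¹ * x) ∂μ‖ = ‖∫ x in V, (ω y⁻¹ : ℂ) * H (y⁻¹ * x) ∂μ‖ := by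
        rw [integral_const_mul, norm_mul, Complex.norm_real, Real.norm_eq_abs,
          abs_of_pos (ω.pos _)]
    _ ≤ ∫ x in V, S * (‖H (y⁻¹ * x)‖ * ω (y⁻¹ * x)) ∂μ := by
        refine norm_integral_le_of_norm_le hint'.integrableOn ?_
        filter_upwards [ae_restrict_mem hV] with x hx
        rw [norm_mul, Complex.norm_real, Real.norm_eq_abs, abs_of_pos (ω.pos _)]
        have h1 : ω y⁻¹ ≤ ω (y⁻¹ * x) * S := by
          have := ω.mul_le (y⁻¹ * x) x⁻¹
          rw [mul_inv_cancel_right] at this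
          exact this.trans (mul_le_mul_of_nonneg_left (hS x hx) (ω.pos _).le)
        calc _ ≤ ω (y⁻¹ * x) * S * ‖H (y⁻¹ * x)‖ := mul_le_mul_of_nonneg_right h1 (norm_nonneg _)
          _ = _ := by ring
    _ ≤ ∫ x, S * (‖H (y⁻¹ * x)‖ * ω (y⁻¹ * x)) ∂μ :=
        setIntegral_le_integral hint' (Eventually.of_forall fun x =>
          mul_nonneg hS0 (mul_nonneg (norm_nonneg _) (ω.pos _).le))
    _ = S * ∫ x, ‖H x‖ * ω x ∂μ := by
        rw [integral_mul_left_eq_self (fun x => S * (‖H x‖ * ω x)), integral_const_mul]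

end trace

namespace BeurlingAlgebra

variable {G : Type*} [Group G] [TopologicalSpace G] [IsTopologicalGroup G] [LocallyCompactSpace G]
  [T2Space G] [MeasurableSpace G] [BorelSpace G]
  {μ : Measure G} [μ.IsHaarMeasure] [μ.Regular] {ω : Weight G}

theorem integralCLM_indicator_ofCompactlySupported {V : Set G} (hV : MeasurableSet V) {C : ℝ}
    (hm : IsWeightBounded ω (V.indicator fun _ => 1) C) (F : C_c(G, ℂ)) :
    integralCLM hm (ofCompactlySupported μ ω F) = ∫ x in V, F x ∂μ := by
  rw [ofCompactlySupported_apply, integralCLM_mk, ← integral_indicator hV]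
  congr 1 with x
  by_cases hx : x ∈ V <;> simp [hx]

theorem integralCLM_mul_comm {V : Set G} (hV : IsInvariantOpen V)
    (hμ : ∀ g : G, μ.map (conjEquiv g) = μ) {C : ℝ}
    (hm : IsWeightBounded ω (V.indicator fun _ => 1) C) (a b : BeurlingAlgebra μ ω) :
    integralCLM hm (a * b) = integralCLM hm (b * a) := by
  refine denseRange_ofCompactlySupported.induction_on₂
    (p := fun a b => integralCLM hm (a * b) = integralCLM hm (b * a)) ?_ (fun F H => ?_) a b
  · exact isClosed_eq (by fun_prop) (by fun_prop)
  · rw [← ofCompactlySupported_conv, ← ofCompactlySupported_conv,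
      integralCLM_indicator_ofCompactlySupported hV.isOpen.measurableSet,
      integralCLM_indicator_ofCompactlySupported hV.isOpen.measurableSet]
    exact setIntegral_groupConv_comm μ hV hμ F H

/-! ### The bilinear form of an additive character -/

/-- Pointwise multiplication of compactly supported functions by a continuous function. -/
noncomputable def mulCompactlySupported (Φ : C(G, ℂ)) : C_c(G, ℂ) →ₗ[ℂ] C_c(G, ℂ) where
  toFun F := Φ • F
  map_add' F H := by ext x; simp [mul_add]
  map_smul' c F := by ext x; simp [mul_left_comm]

/-- Multiplication by an additive character is a derivation for the convolution. -/
theorem mulCompactlySupported_conv {Φ : C(G, ℂ)} (hΦ : ∀ s t, Φ (s * t) = Φ s + Φ t)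
    (F H : C_c(G, ℂ)) :
    mulCompactlySupported Φ (convCompactlySupported μ F H) =
      convCompactlySupported μ (mulCompactlySupported Φ F) H +
        convCompactlySupported μ F (mulCompactlySupported Φ H) := by
  ext x
  change Φ x * groupConv μ F H x = groupConv μ (Φ • F : C_c(G, ℂ)) H x +
    groupConv μ F (Φ • H : C_c(G, ℂ)) x
  unfold groupConv
  rw [← integral_const_mul]
  refine Eq.trans ?_ (integral_add
    (conv_integrable μ (Φ • F).continuous (Φ • F).hasCompactSupport H.continuous x)
    (conv_integrable μ F.continuous F.hasCompactSupport (Φ • H).continuous x))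
  congr 1 with y
  have h1 : Φ x = Φ y + Φ (y⁻¹ * x) := by rw [← hΦ, mul_inv_cancel_left]
  simp only [CompactlySupportedContinuousMap.smulc_apply, smul_eq_mul]
  rw [h1]
  ring

/-- The bilinear form `(F, h) ↦ l((Φ F) * h)` for compactly supported `F`. In the application, `l`
is integration over an invariant set. -/
noncomputable def preForm (l : BeurlingAlgebra μ ω →L[ℂ] ℂ) (Φ : C(G, ℂ)) :
    C_c(G, ℂ) →ₗ[ℂ] BeurlingAlgebra μ ω →L[ℂ] ℂ :=
  ((ContinuousLinearMap.compL ℂ (BeurlingAlgebra μ ω) (BeurlingAlgebra μ ω) ℂ l).comp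
    mulCLM).toLinearMap ∘ₗ ofCompactlySupported μ ω ∘ₗ mulCompactlySupported Φ

theorem preForm_apply (l : BeurlingAlgebra μ ω →L[ℂ] ℂ) (Φ : C(G, ℂ)) (F : C_c(G, ℂ))
    (h : BeurlingAlgebra μ ω) :
    preForm l Φ F h = l (ofCompactlySupported μ ω (mulCompactlySupported Φ F) * h) := rfl

/-- The growth condition on `Φ` makes the form bounded in both arguments, although multiplication by
`Φ` need not be bounded on `L¹(G, ω)`. -/
theorem exists_norm_preForm_le {V : Set G} (hV : IsInvariantOpen V) {C : ℝ}
    (hm : IsWeightBounded ω (V.indicator fun _ => 1) C) {Φ : C(G, ℂ)} {B : ℝ} (hB0 : 0 ≤ B)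
    (hB : ∀ x, ‖Φ x‖ ≤ B * (ω x * ω x⁻¹)) :
    ∃ M, ∀ F, ‖preForm (integralCLM (μ := μ) hm) Φ F‖ ≤ M * ‖ofCompactlySupported μ ω F‖ := by
  obtain ⟨S, hS0, hS'⟩ := ω.bound_of_isCompact μ hV.isCompact_closure.inv
  have hS : ∀ x ∈ V, ω x⁻¹ ≤ S := fun x hx => hS' _ (Set.inv_mem_inv.2 (subset_closure hx))
  refine ⟨B * S, fun F => ContinuousLinearMap.opNorm_le_bound _ (by positivity) fun h => ?_⟩
  refine denseRange_ofCompactlySupported.induction_on (p := fun h =>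
    ‖preForm (integralCLM (μ := μ) hm) Φ F h‖ ≤ B * S * ‖ofCompactlySupported μ ω F‖ * ‖h‖) h
    (isClosed_le (by fun_prop) (by fun_prop)) fun H => ?_
  rw [preForm_apply, ← ofCompactlySupported_conv,
    integralCLM_indicator_ofCompactlySupported hV.isOpen.measurableSet]
  simp only [convCompactlySupported_apply]
  rw [setIntegral_groupConv, norm_eq_integral (ofCompactlySupported μ ω F), mul_assoc,
    mul_comm (∫ x, _ ∂μ), ← mul_assoc, ← integral_const_mul]
  refine norm_integral_le_of_norm_le ((integrable_norm_mul _).const_mul _) ?_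
  filter_upwards [ae_haar (coeFn_mk (memLp_of_compactlySupported μ ω F))] with y hy
  have h1 := ω.mul_norm_setIntegral_le μ hV.isOpen.measurableSet hS0.le hS H y
  rw [← norm_mk (memLp_of_compactlySupported μ ω H), ← ofCompactlySupported_apply] at h1
  rw [ofCompactlySupported_apply F, hy, norm_mul]
  change ‖Φ y * F y‖ * _ ≤ _
  rw [norm_mul]
  have hω := (ω.pos y).le
  calc ‖Φ y‖ * ‖F y‖ * ‖∫ x in V, H (y⁻¹ * x) ∂μ‖
      ≤ B * (ω y * ω y⁻¹) * ‖F y‖ * ‖∫ x in V, H (y⁻¹ * x) ∂μ‖ := by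
        gcongr
        exact hB y
    _ = B * ω y * ‖F y‖ * (ω y⁻¹ * ‖∫ x in V, H (y⁻¹ * x) ∂μ‖) := by ring
    _ ≤ B * ω y * ‖F y‖ * (S * ‖ofCompactlySupported μ ω H‖) := by gcongr
    _ = _ := by ring

/-- The continuous extension to `L¹(G, ω)` of the bilinear form `(F, h) ↦ l((Φ F) * h)`. It extends
`preForm` only if the latter is bounded, which the lemmas below assume. -/
noncomputable def form (l : BeurlingAlgebra μ ω →L[ℂ] ℂ) (Φ : C(G, ℂ)) :
    BeurlingAlgebra μ ω →L[ℂ] BeurlingAlgebra μ ω →L[ℂ] ℂ :=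
  (preForm l Φ).extendOfNorm (ofCompactlySupported μ ω)

theorem form_ofCompactlySupported {l : BeurlingAlgebra μ ω →L[ℂ] ℂ} {Φ : C(G, ℂ)}
    (hle : ∃ M, ∀ F, ‖preForm l Φ F‖ ≤ M * ‖ofCompactlySupported μ ω F‖) (F : C_c(G, ℂ)) :
    form l Φ (ofCompactlySupported μ ω F) = preForm l Φ F :=
  LinearMap.extendOfNorm_eq denseRange_ofCompactlySupported hle F

/-- The Leibniz rule for the form. The trace property of `l` and the centrality of `h` move the
factor `a` past `Φ b` and `h`. -/
theorem form_mul {l : BeurlingAlgebra μ ω →L[ℂ] ℂ} {Φ : C(G, ℂ)}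
    (hΦ : ∀ s t, Φ (s * t) = Φ s + Φ t) (hl : ∀ a b, l (a * b) = l (b * a))
    (hle : ∃ M, ∀ F, ‖preForm l Φ F‖ ≤ M * ‖ofCompactlySupported μ ω F‖)
    {h : BeurlingAlgebra μ ω} (hh : IsCentral h) (a b : BeurlingAlgebra μ ω) :
    form l Φ (a * b) h = form l Φ a (b * h) + form l Φ b (a * h) := by
  have heq := form_ofCompactlySupported hle
  refine denseRange_ofCompactlySupported.induction_on₂ (p := fun a b =>
    form l Φ (a * b) h = form l Φ a (b * h) + form l Φ b (a * h)) ?_ (fun F H => ?_) a b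
  · exact isClosed_eq (by fun_prop) (by fun_prop)
  · rw [← ofCompactlySupported_conv, heq, heq, heq, preForm_apply, preForm_apply, preForm_apply,
      mulCompactlySupported_conv hΦ, map_add, ofCompactlySupported_conv, ofCompactlySupported_conv,
      add_mul, map_add, mul_assoc]
    congr 1
    rw [mul_assoc, hl, mul_assoc, hh.mul_comm]

theorem tendsto_apply₂ (T : BeurlingAlgebra μ ω →L[ℂ] BeurlingAlgebra μ ω →L[ℂ] ℂ)
    {f h : BeurlingAlgebra μ ω} {F H : ℕ → BeurlingAlgebra μ ω}
    (hF : Tendsto F atTop (𝓝 f)) (hH : Tendsto H atTop (𝓝 h)) :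
    Tendsto (fun n => T (F n) (H n)) atTop (𝓝 (T f h)) :=
  (T.continuous₂.tendsto (f, h)).comp (hF.prodMk_nhds hH)

/-- If `f` and `h` are supported in a compact set with a neighbourhood `L` such that `L L ⊆ V`, the
form is `(∫ Φ f) (∫ h)`. -/
theorem form_eq_of_support {V K L : Set G} (hV : IsInvariantOpen V) {C : ℝ}
    (hm : IsWeightBounded ω (V.indicator fun _ => 1) C) {Φ : C(G, ℂ)}
    (hle : ∃ M, ∀ F, ‖preForm (integralCLM (μ := μ) hm) Φ F‖ ≤ M * ‖ofCompactlySupported μ ω F‖)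
    (hK : IsCompact K) (hL : IsCompact L) (hKL : K ⊆ interior L) (hLV : L * L ⊆ V)
    {f h : BeurlingAlgebra μ ω} (hf : ∀ᵐ x ∂μ, x ∉ K → f x = 0)
    (hh : ∀ᵐ x ∂μ, x ∉ K → h x = 0) :
    form (integralCLM hm) Φ f h = (∫ x, Φ x * f x ∂μ) * ∫ x, h x ∂μ := by
  obtain ⟨F, hF, hFl⟩ := exists_seq_support_subset hK hKL hf
  obtain ⟨H, hH, hHl⟩ := exists_seq_support_subset hK hKL hh
  obtain ⟨C₁, h₁⟩ := exists_isWeightBounded_indicator μ ω hL subset_rfl hL.measurableSet Φ.continuous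
  obtain ⟨C₂, h₂⟩ := exists_isWeightBounded_indicator μ ω hL subset_rfl hL.measurableSet
    (continuous_const (y := (1 : ℂ)))
  -- On functions supported in `L`, both integrals are continuous functionals on `L¹(G, ω)`.
  have hcut : ∀ {m k : G → ℂ}, (∀ᵐ x ∂μ, x ∉ L → k x = 0) →
      ∫ x, L.indicator m x * k x ∂μ = ∫ x, m x * k x ∂μ := by
    intro m k hk
    refine integral_congr_ae ?_
    filter_upwards [hk] with x hx
    by_cases hxL : x ∈ L
    · rw [Set.indicator_of_mem hxL]
    · rw [hx hxL, mul_zero, mul_zero]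
  have hKL' : ∀ x, x ∉ L → x ∉ K := fun x hx hxK => hx (interior_subset (hKL hxK))
  have e1 : integralCLM h₁ f = ∫ x, Φ x * f x ∂μ := by
    rw [integralCLM_apply, hcut (hf.mono fun x hx hxL => hx (hKL' x hxL))]
  have e2 : integralCLM h₂ h = ∫ x, h x ∂μ := by
    rw [integralCLM_apply, hcut (hh.mono fun x hx hxL => hx (hKL' x hxL))]
    simp only [one_mul]
  have hlim₁ := tendsto_apply₂ (form (integralCLM hm) Φ) hFl hHl
  have hlim₂ := (((integralCLM (μ := μ) h₁).continuous.tendsto f).comp hFl).mul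
    (((integralCLM (μ := μ) h₂).continuous.tendsto h).comp hHl)
  rw [e1, e2] at hlim₂
  refine tendsto_nhds_unique hlim₁ (hlim₂.congr fun n => ?_)
  rw [form_ofCompactlySupported hle, preForm_apply, ← ofCompactlySupported_conv,
    integralCLM_indicator_ofCompactlySupported hV.isOpen.measurableSet]
  simp only [convCompactlySupported_apply, Function.comp_apply]
  have hΦF : ∀ x, mulCompactlySupported Φ (F n) x = Φ x * F n x := fun x => rfl
  have hΦF0 : ∀ x, x ∉ L → mulCompactlySupported Φ (F n) x = 0 := fun x hx => by
    rw [hΦF, hF n x hx, mul_zero]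
  have c1 := hcut (m := Φ) (Eventually.of_forall (hF n))
  have c2 := hcut (m := fun _ => 1) (Eventually.of_forall (hH n))
  rw [setIntegral_groupConv_of_support μ hLV hΦF0 (hH n), ofCompactlySupported_apply,
    ofCompactlySupported_apply, integralCLM_mk, integralCLM_mk, c1, c2]
  simp only [one_mul, hΦF]

end BeurlingAlgebra

/-! ### The derivation on the central Beurling algebra -/

section derivation

variable {G : Type*} [Group G] [TopologicalSpace G] [IsTopologicalGroup G] [LocallyCompactSpace G]
  [T2Space G] [MeasurableSpace G] [BorelSpace G]
  {μ : Measure G} [μ.IsHaarMeasure] [μ.Regular] {ω : Weight G}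

variable (μ ω) in
/-- The inclusion of `ZL¹(G, ω)` into `L¹(G, ω)`. -/
noncomputable def centralInclusion : centralBeurlingAlgebra μ ω →L[ℂ] BeurlingAlgebra μ ω :=
  LinearMap.mkContinuous
    { toFun := fun f => (f : BeurlingAlgebra μ ω)
      map_add' := fun _ _ => rfl
      map_smul' := fun _ _ => rfl } 1 fun f => by
    rw [one_mul]
    exact le_rfl

variable (μ ω) in
/-- The action `(a · φ)(h) = φ(a h)` of `ZL¹(G, ω)` on its dual space. -/
noncomputable def dualAction : centralBeurlingAlgebra μ ω →L[ℂ]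
    (centralBeurlingAlgebra μ ω →L[ℂ] ℂ) →L[ℂ] (centralBeurlingAlgebra μ ω →L[ℂ] ℂ) :=
  (ContinuousLinearMap.compL ℂ (centralBeurlingAlgebra μ ω)
    (centralBeurlingAlgebra μ ω) ℂ).flip.comp
    (ContinuousLinearMap.mul ℂ (centralBeurlingAlgebra μ ω))

theorem dualAction_apply (a h : centralBeurlingAlgebra μ ω)
    (φ : centralBeurlingAlgebra μ ω →L[ℂ] ℂ) : dualAction μ ω a φ h = φ (a * h) := rfl

/-- A bilinear form on `L¹(G, ω)` that satisfies the Leibniz rule of `BeurlingAlgebra.form_mul` on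
`ZL¹(G, ω)` vanishes there if `ZL¹(G, ω)` is weakly amenable. -/
theorem IsWeaklyAmenable.form_eq_zero (hA : IsWeaklyAmenable (centralBeurlingAlgebra μ ω))
    (T : BeurlingAlgebra μ ω →L[ℂ] BeurlingAlgebra μ ω →L[ℂ] ℂ)
    (hT : ∀ a b h : BeurlingAlgebra μ ω, BeurlingAlgebra.IsCentral h →
      T (a * b) h = T a (b * h) + T b (a * h))
    {f h : BeurlingAlgebra μ ω} (hf : BeurlingAlgebra.IsCentral f)
    (hh : BeurlingAlgebra.IsCentral h) : T f h = 0 := by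
  let D : centralBeurlingAlgebra μ ω →L[ℂ] centralBeurlingAlgebra μ ω →L[ℂ] ℂ :=
    ((ContinuousLinearMap.compL ℂ (centralBeurlingAlgebra μ ω) (BeurlingAlgebra μ ω) ℂ).flip
      (centralInclusion μ ω)).comp (T.comp (centralInclusion μ ω))
  have hD : ∀ a b, D a b = T a b := fun _ _ => rfl
  have h0 : D = 0 := by
    refine hA (centralBeurlingAlgebra μ ω →L[ℂ] ℂ) (dualAction μ ω) (fun a b φ => ?_) D
      fun a b => ?_
    · ext h
      rw [dualAction_apply, dualAction_apply, dualAction_apply, mul_left_comm, mul_assoc]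
    · ext h
      rw [add_apply, dualAction_apply, dualAction_apply, hD, hD, hD, add_comm]
      exact hT a b h h.2
  have h1 := hD ⟨f, hf⟩ ⟨h, hh⟩
  rw [h0] at h1
  exact h1.symm

theorem IsInvariantOpen.isCentral_indicator {W : Set G} (hW : IsInvariantOpen W) {k : G → ℂ}
    (hk : Continuous k) (hkc : ∀ g x, k (g⁻¹ * x * g) = k x) :
    BeurlingAlgebra.IsCentral
      (BeurlingAlgebra.mk _ (ω.memLp_indicator μ hW.isOpen hW.isCompact_closure hk)) := by
  refine BeurlingAlgebra.isCentral_of_ae (BeurlingAlgebra.coeFn_mk _) fun g =>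
    Eventually.of_forall fun x => ?_
  by_cases hx : x ∈ W
  · simp only [Set.indicator_of_mem hx, Set.indicator_of_mem ((hW.conj_mem_iff g x).2 hx), hkc]
  · simp only [Set.indicator_of_notMem hx,
      Set.indicator_of_notMem fun h => hx ((hW.conj_mem_iff g x).1 h)]

end derivation

theorem proposition2p8 {G : Type*} [Group G] [TopologicalSpace G] [IsTopologicalGroup G]
    [LocallyCompactSpace G] [T2Space G] [MeasurableSpace G] [BorelSpace G]
    (μ : Measure G) [μ.IsHaarMeasure] [μ.Regular] (hG : IsFCGroup G) (ω : Weight G)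
    (Φ : G → ℂ) (hΦ_cont : Continuous Φ) (hΦ_hom : ∀ s t : G, Φ (s * t) = Φ s + Φ t)
    (hΦ_ne : ∃ t : G, Φ t ≠ 0)
    (hΦ_bdd : BddAbove (Set.range fun t : G => ‖Φ t‖ / (ω t * ω t⁻¹))) :
    ¬ IsWeaklyAmenable (centralBeurlingAlgebra μ ω) := by
  intro hA
  obtain ⟨t, ht⟩ := hΦ_ne
  obtain ⟨B, hB⟩ := hΦ_bdd
  have hBle : ∀ x, ‖Φ x‖ ≤ max B 0 * (ω x * ω x⁻¹) := fun x => by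
    have hpos := mul_pos (ω.pos x) (ω.pos x⁻¹)
    rw [← div_le_iff₀ hpos]
    exact (hB ⟨x, rfl⟩).trans (le_max_left _ _)
  -- The test functions live on `W`, and the form integrates over `V`, which contains `L * L` for a
  -- compact neighbourhood `L` of the closure of `W`.
  obtain ⟨W, htW, hW⟩ := hG.exists_isInvariantOpen (isCompact_singleton (x := t))
  have htW : t ∈ W := htW rfl
  obtain ⟨L, hL, hWL⟩ := exists_compact_superset hW.isCompact_closure
  obtain ⟨V, hLV, hV⟩ := hG.exists_isInvariantOpen (hL.mul hL)
  obtain ⟨C, hm⟩ := BeurlingAlgebra.exists_isWeightBounded_indicator μ ω hV.isCompact_closure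
    subset_closure hV.isOpen.measurableSet (continuous_const (y := (1 : ℂ)))
  have hμ := hW.map_conj_eq_self μ ⟨t, htW⟩
  let Ψ : C(G, ℂ) := ⟨Φ, hΦ_cont⟩
  have hle := BeurlingAlgebra.exists_norm_preForm_le (μ := μ) hV hm (Φ := Ψ) (le_max_right B 0) hBle
  have hconj : ∀ g x, Φ (g⁻¹ * x * g) = Φ x := fun g x => by
    rw [hΦ_hom, add_comm, ← hΦ_hom, mul_inv_cancel_left]
  have hk₁ : Continuous fun x => star (Φ x) := hΦ_cont.star
  have hk₂ : Continuous fun _ : G => (1 : ℂ) := continuous_const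
  have hzero := hA.form_eq_zero _ (fun a b h hh => BeurlingAlgebra.form_mul (Φ := Ψ) hΦ_hom
    (BeurlingAlgebra.integralCLM_mul_comm hV hμ hm) hle hh a b)
    (hW.isCentral_indicator hk₁ fun g x => by rw [hconj])
    (hW.isCentral_indicator hk₂ fun _ _ => rfl)
  have hf₁ := BeurlingAlgebra.ae_haar (BeurlingAlgebra.coeFn_mk
    (ω.memLp_indicator μ hW.isOpen hW.isCompact_closure hk₁))
  have hf₂ := BeurlingAlgebra.ae_haar (BeurlingAlgebra.coeFn_mk
    (ω.memLp_indicator μ hW.isOpen hW.isCompact_closure hk₂))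
  rw [BeurlingAlgebra.form_eq_of_support hV hm hle hW.isCompact_closure hL hWL hLV
    (hf₁.mono fun x hx hxW => by
      rw [hx, Set.indicator_of_notMem fun h => hxW (subset_closure h)])
    (hf₂.mono fun x hx hxW => by
      rw [hx, Set.indicator_of_notMem fun h => hxW (subset_closure h)])] at hzero
  have hWm := hW.isOpen.measurableSet
  have hWfin : μ W ≠ ∞ :=
    ((measure_mono subset_closure).trans_lt hW.isCompact_closure.measure_lt_top).ne
  have e₁ : ∫ x, Ψ x * BeurlingAlgebra.mk _
      (ω.memLp_indicator μ hW.isOpen hW.isCompact_closure hk₁) x ∂μ =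
      ((∫ x in W, ‖Φ x‖ ^ 2 ∂μ : ℝ) : ℂ) := by
    rw [← integral_complex_ofReal, ← integral_indicator hWm]
    refine integral_congr_ae ?_
    filter_upwards [hf₁] with x hx
    rw [hx]
    by_cases hxW : x ∈ W
    · rw [Set.indicator_of_mem hxW, Set.indicator_of_mem hxW]
      push_cast
      exact Complex.mul_conj' (Φ x)
    · rw [Set.indicator_of_notMem hxW, Set.indicator_of_notMem hxW, mul_zero]
  have e₂ : ∫ x, BeurlingAlgebra.mk _
      (ω.memLp_indicator μ hW.isOpen hW.isCompact_closure hk₂) x ∂μ = (μ.real W : ℂ) := by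
    rw [integral_congr_ae hf₂, integral_indicator hWm, setIntegral_const]
    simp
  rw [e₁, e₂] at hzero
  have hWpos : 0 < μ.real W := ENNReal.toReal_pos (hW.isOpen.measure_pos μ ⟨t, htW⟩).ne' hWfin
  have hΦpos : 0 < ∫ x in W, ‖Φ x‖ ^ 2 ∂μ := by
    have hc : Continuous fun x => ‖Φ x‖ ^ 2 := by fun_prop
    rw [setIntegral_pos_iff_support_of_nonneg_ae (Eventually.of_forall fun x => by positivity)
      ((hc.continuousOn.integrableOn_compact hW.isCompact_closure).mono_set subset_closure)]
    exact (hc.isOpen_support.inter hW.isOpen).measure_pos μ ⟨t, by simpa using ht, htW⟩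
  rcases mul_eq_zero.1 hzero with h | h
  · exact hΦpos.ne' (Complex.ofReal_eq_zero.1 h)
  · exact hWpos.ne' (Complex.ofReal_eq_zero.1 h)
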